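/- Let $G$ be a finite connected simple graph with vertex set $V$. The choice random walk (CRW) on $G$ from $v\in V$ starts at $X_0=v$; at each time $t\ge 0$ a controller is offered two independent uniformly random neighbours $c_1^t,c_2^t$ of the current vertex $X_t$ (with repetition) and picks one of them as $X_{t+1}$. A strategy is a rule which, at each time $t$, makes this pick, possibly using extra randomness, as a function of $t$ and of the history $(X_i,c_1^i,c_2^i)_{0\le i\le t}$. For $x,y\in V$ let $H_x(y)$ be the minimum over all strategies of the expected first time at which the CRW from $x$ is at $y$, and let $C_v$ be the minimum over all strategies of the expected first time by which the CRW from $v$ has visited every vertex. Define the optimal CRW hitting and cover times $$t^{\mathsf{two}}_{\mathsf{hit}}(G)=\max_{x,y\in V}H_x(y),\qquad t^{\mathsf{two}}_{\mathsf{cov}}(G)=\max_{v\in V}C_v .$$ The relaxation time of $G$ is $t_{\mathsf{rel}}(G)=1/(1-\lambda_2)$, where $\lambda_2$ is the second largest eigenvalue (with multiplicity) of the transition matrix of the lazy random walk on $G$ with loop probability $1/2$. Let $(G_n)_{n\ge 1}$ be a sequence of connected simple graphs such that $G_n$ has $n$ vertices, the maximum degrees of the $G_n$ are bounded by a constant not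 depending on $n$, and $t_{\mathsf{rel}}(G_n)=\Theta(1)$ as $n\to\infty$. Then, as $n\to\infty$, $$t^{\mathsf{two}}_{\mathsf{cov}}(G_n)=O(n\log\log n)\qquad\text{and}\qquad t^{\mathsf{two}}_{\mathsf{hit}}(G_n)=o(n).$$ -/

import Mathlib

open MeasureTheory ProbabilityTheory Filter Asymptotics Topology
open scoped ENNReal

namespace ChoiceWalk

/-! ### Relaxation time -/

/-- Transition matrix of the simple random walk on `G`. -/
noncomputable def walkMatrix {V : Type*} [Fintype V] (G : SimpleGraph V)
    [DecidableRel G.Adj] : Matrix V V ℝ :=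
  Matrix.of fun x y => if G.Adj x y then 1 / (G.degree x : ℝ) else 0

/-- Transition matrix of the lazy random walk on `G`, with loop probability `1/2`. -/
noncomputable def lazyWalkMatrix {V : Type*} [Fintype V] [DecidableEq V] (G : SimpleGraph V)
    [DecidableRel G.Adj] : Matrix V V ℝ :=
  (1 / 2 : ℝ) • (1 + walkMatrix G)

/-- The second largest eigenvalue of a real square matrix all of whose eigenvalues are real:
the eigenvalues are listed with multiplicity in decreasing order, and the entry in position `1`
(counting from `0`) is taken. (Value `0` if there is no such entry.) -/
noncomputable def secondEigenvalue {V : Type*} [Fintype V] [DecidableEq V]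
    (A : Matrix V V ℝ) : ℝ :=
  (A.charpoly.roots.sort (fun a b => b ≤ a)).getD 1 0

/-- The relaxation time `1 / (1 - lam₂)` of `G`, where `lam₂` is the second largest eigenvalue of
the lazy random walk. -/
noncomputable def relaxationTime {V : Type*} [Fintype V] [DecidableEq V] (G : SimpleGraph V)
    [DecidableRel G.Adj] : ℝ :=
  1 / (1 - secondEigenvalue (lazyWalkMatrix G))

/-! ### The choice random walk -/

/-- What is recorded at one time `t`: the position `X_t` and the two neighbours of `X_t` that are
offered to the controller at time `t`. -/
@[ext]
structure Stage (V : Type*) where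
  pos : V
  offer₁ : V
  offer₂ : V

/-- The discrete sigma-algebra. -/
instance {V : Type*} : MeasurableSpace (Stage V) := ⊤

instance {V : Type*} : DiscreteMeasurableSpace (Stage V) := ⟨fun _ => trivial⟩

instance {V : Type*} [Finite V] : Finite (Stage V) :=
  Finite.of_injective (fun s : Stage V => (s.pos, s.offer₁, s.offer₂)) (by
    intro s t h
    simp only [Prod.mk.injEq] at h
    exact Stage.ext h.1 h.2.1 h.2.2)

/-- The history up to and including time `t`: positions and offers at the times `0, …, t`. -/
abbrev History (V : Type*) (t : ℕ) : Type _ := (Finset.Iic t) → Stage V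

/-- The most recent entry of a history. -/
def History.last {V : Type*} {t : ℕ} (h : History V t) : Stage V :=
  h ⟨t, Finset.mem_Iic.2 le_rfl⟩

/-- A strategy of the controller: at each time `t`, given the whole history up to time `t`
(including the current position and the current offers), the probability with which the vertex
`offer₁` is taken as the next position; otherwise `offer₂` is taken. -/
abbrev Strategy (V : Type*) : Type _ := (t : ℕ) → History V t → unitInterval

/-- The law of the stage recorded when the walk arrives at `v`: the two offers are independent
uniformly random neighbours of `v`, with repetition, that is, the pair of offers is uniform on
`Γ(v) × Γ(v)`. (At an isolated vertex the walk can only stay where it is.) -/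
noncomputable def arrive {V : Type*} [Fintype V] (G : SimpleGraph V)
    [DecidableRel G.Adj] (v : V) : PMF (Stage V) :=
  if hv : (G.neighborFinset v ×ˢ G.neighborFinset v).Nonempty then
    (PMF.uniformOfFinset (G.neighborFinset v ×ˢ G.neighborFinset v) hv).map
      fun c => ⟨v, c.1, c.2⟩
  else PMF.pure ⟨v, v, v⟩

/-- The law of the stage at time `t + 1` given the history `h` up to time `t`, under the
strategy `α`. -/
noncomputable def stepLaw {V : Type*} [Fintype V] (G : SimpleGraph V)
    [DecidableRel G.Adj] (α : Strategy V) (t : ℕ) (h : History V t) : Measure (Stage V) :=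
  ENNReal.ofReal (α t h) • (arrive G h.last.offer₁).toMeasure
    + ENNReal.ofReal (1 - α t h) • (arrive G h.last.offer₂).toMeasure

/-- `stepLaw` as a transition kernel from histories to stages. -/
noncomputable def stepKernel {V : Type*} [Fintype V] (G : SimpleGraph V)
    [DecidableRel G.Adj] (α : Strategy V) (t : ℕ) : Kernel (History V t) (Stage V) :=
  Kernel.ofFunOfCountable (stepLaw G α t)

instance {V : Type*} [Fintype V] (G : SimpleGraph V) [DecidableRel G.Adj] (α : Strategy V)
    (t : ℕ) : IsMarkovKernel (stepKernel G α t) := by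
  refine ⟨fun h => ⟨?_⟩⟩
  change stepLaw G α t h Set.univ = 1
  rw [stepLaw, Measure.add_apply, Measure.smul_apply, Measure.smul_apply, measure_univ,
    measure_univ, smul_eq_mul, smul_eq_mul, mul_one, mul_one,
    ← ENNReal.ofReal_add (α t h).2.1 (sub_nonneg.2 (α t h).2.2), add_sub_cancel,
    ENNReal.ofReal_one]

/-- The law, on the space of infinite trajectories, of the choice random walk on `G` started
from `v` and controlled by the strategy `α`. -/
noncomputable def walkLaw {V : Type*} [Fintype V] (G : SimpleGraph V)
    [DecidableRel G.Adj] (α : Strategy V) (v : V) : Measure (ℕ → Stage V) :=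
  Kernel.trajMeasure (X := fun _ => Stage V) (arrive G v).toMeasure (stepKernel G α)

/-- The first time at which the trajectory `ω` is at `y` (`∞` if there is none). -/
noncomputable def hitAt {V : Type*} (y : V) (ω : ℕ → Stage V) : ℝ≥0∞ :=
  ⨅ (t : ℕ) (_ : (ω t).pos = y), (t : ℝ≥0∞)

/-- The first time by which the trajectory `ω` has visited every vertex (`∞` if there is none). -/
noncomputable def coverAt {V : Type*} (ω : ℕ → Stage V) : ℝ≥0∞ :=
  ⨅ (t : ℕ) (_ : ∀ y : V, ∃ s ≤ t, (ω s).pos = y), (t : ℝ≥0∞)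

/-- The optimal hitting time of `G`: the maximum over all pairs of vertices `x`, `y` of the least
expected time, over all strategies, for the choice random walk to get from `x` to `y`. -/
noncomputable def hittingTime {V : Type*} [Fintype V] (G : SimpleGraph V)
    [DecidableRel G.Adj] : ℝ≥0∞ :=
  ⨆ (x : V) (y : V), ⨅ α : Strategy V, ∫⁻ ω, hitAt y ω ∂(walkLaw G α x)

/-- The optimal cover time of `G`: the maximum over all starting vertices `v` of the least
expected time, over all strategies, for the choice random walk from `v` to visit every vertex. -/
noncomputable def coverTime {V : Type*} [Fintype V] (G : SimpleGraph V)
    [DecidableRel G.Adj] : ℝ≥0∞ :=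
  ⨆ v : V, ⨅ α : Strategy V, ∫⁻ ω, coverAt ω ∂(walkLaw G α v)

end ChoiceWalk

/-! Let `D ≥ 2` bound the degrees and put `β = 1 - 1/D`. The power `β` measures exactly what the
second offer buys: if `p ≥ 0` has mean `a` over the neighbours of `x`, then the expected value of
`max(p(c₁), p(c₂)) ^ β` over two random neighbours is at least `a ^ β`
(`rpow_mean_le_mean_max_rpow`). So a greedy controller turns a function that is subharmonic for the
simple walk into one whose `β`-th power is a submartingale.

For a target set `S`, take `p = reachFun G T S`, the best discounted probability that the lazy walk
is in `S` at a fixed time up to a mixing time `T = O(log n)`. The spectral gap gives `p ≥ |S| /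
(6Dn)` everywhere, and the discount gives growth by the factor `1 + 2/T` on average off `S`. Under
greedy play `p ^ β` therefore gains a factor `1 + 1/(2T)` per step, and with `K = 2T (6Dn/|S|) ^ β`
the potential `K (1 - p ^ β)` drops by at least one per expected step. Hitting `S` thus costs at
most `K`. For a single vertex this is `O(n ^ (1 - 1/D) log n) = o(n)`.

Collecting all `n` vertices greedily would cost order `n log n` by this bound, because the factor
`T` is paid for large `S` too. Hence the controller ignores its choice for `Θ(n log log n)` steps:
each vertex is hit by the simple walk in expected time `O(n)`, so the expected number of missed
vertices falls to `O(n / (log n) ^ (2D+1))`. The greedy rule then collects the rest in expected time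
`O(n)`. As only the expected number of missed vertices is controlled, the greedy cost is first
bounded by an affine function of that number (`coverCost_le`).

Strategies and trajectory measures enter only through `exists_strategy_lintegral_coverOf_le`, which
turns a potential with drift `-1` into a bound on expected cover time; everything else is analysis
on a finite graph. -/

namespace ChoiceWalk

/-! ### The uniform law of a pair of offers. -/

section Offers

variable {V : Type*} [Fintype V] (G : SimpleGraph V) [DecidableRel G.Adj]

/-- Pairs of offers at `x`. -/
def offers (x : V) : Finset (V × V) := G.neighborFinset x ×ˢ G.neighborFinset x

lemma card_offers (x : V) : (offers G x).card = G.degree x ^ 2 := by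
  simp [offers, sq]

lemma lintegral_arrive {x : V} (hx : 0 < G.degree x) (g : Stage V → ℝ≥0∞) :
    ∫⁻ s, g s ∂(arrive G x).toMeasure
      = ((offers G x).card : ℝ≥0∞)⁻¹ * ∑ c ∈ offers G x, g ⟨x, c.1, c.2⟩ := by
  let _ : MeasurableSpace (V × V) := ⊤
  have : DiscreteMeasurableSpace (V × V) := ⟨fun _ => trivial⟩
  have hne : (G.neighborFinset x ×ˢ G.neighborFinset x).Nonempty := by
    have : (G.neighborFinset x).Nonempty := by
      rw [← Finset.card_pos, SimpleGraph.card_neighborFinset_eq_degree]; exact hx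
    exact this.product this
  have hg : Measurable g := measurable_of_countable g
  rw [arrive, dif_pos hne, ← PMF.toMeasure_map (hf := measurable_of_countable _),
    lintegral_map hg (measurable_of_countable _), lintegral_fintype, Finset.mul_sum]
  rw [← Finset.sum_subset (Finset.subset_univ (offers G x))]
  · refine Finset.sum_congr rfl fun c hc => ?_
    rw [PMF.toMeasure_apply_singleton _ _ (measurableSet_singleton c),
      PMF.uniformOfFinset_apply_of_mem _ (by exact hc), mul_comm]
    rfl
  · intro c _ hc
    rw [PMF.toMeasure_apply_singleton _ _ (measurableSet_singleton c),
      PMF.uniformOfFinset_apply_of_notMem _ (by exact hc), mul_zero]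

end Offers

/-! ### Unvisited targets along a trajectory. -/

section Trajectories

variable {V : Type*}

/-- The history up to time `t` of a trajectory. -/
def past (t : ℕ) (ω : ℕ → Stage V) : History V t :=
  Preorder.frestrictLe (π := fun _ => Stage V) t ω

lemma measurable_past (t : ℕ) : Measurable (past (V := V) t) :=
  Preorder.measurable_frestrictLe (X := fun _ => Stage V) t

/-- The first time by which the trajectory has visited all of `Y`. -/
noncomputable def coverOf (Y : Finset V) (ω : ℕ → Stage V) : ℝ≥0∞ :=
  ⨅ (t : ℕ) (_ : ∀ y ∈ Y, ∃ s ≤ t, (ω s).pos = y), (t : ℝ≥0∞)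

lemma hitAt_le_coverOf_singleton (y : V) (ω : ℕ → Stage V) : hitAt y ω ≤ coverOf {y} ω := by
  refine le_iInf₂ fun t ht => ?_
  obtain ⟨s, hs, h⟩ := ht y (Finset.mem_singleton_self y)
  exact (iInf₂_le s h).trans (by exact_mod_cast hs)

lemma coverAt_eq_coverOf_univ [Fintype V] (ω : ℕ → Stage V) : coverAt ω = coverOf Finset.univ ω := by
  simp [coverAt, coverOf]

variable [DecidableEq V]

/-- The targets in `Y` that do not occur in the history `h`. -/
def unvisited (Y : Finset V) {t : ℕ} (h : History V t) : Finset V :=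
  Y.filter fun y => ∀ i, (h i).pos ≠ y

lemma unvisited_past_succ (Y : Finset V) (t : ℕ) (ω : ℕ → Stage V) :
    unvisited Y (past (t + 1) ω) = (unvisited Y (past t ω)).erase (ω (t + 1)).pos := by
  ext y
  simp only [unvisited, past, Finset.mem_filter, Finset.mem_erase, Preorder.frestrictLe_apply,
    Subtype.forall, Finset.mem_Iic]
  constructor
  · rintro ⟨hy, h⟩
    exact ⟨(h (t + 1) le_rfl).symm, hy, fun i hi => h i (hi.trans (Nat.le_succ t))⟩
  · rintro ⟨h1, hy, h⟩
    refine ⟨hy, fun i hi => ?_⟩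
    rcases Nat.le_succ_iff.1 hi with hi | rfl
    · exact h i hi
    · exact h1.symm

lemma unvisited_past_zero (Y : Finset V) (ω : ℕ → Stage V) :
    unvisited Y (past 0 ω) = Y.erase (ω 0).pos := by
  ext y
  simp only [unvisited, past, Finset.mem_filter, Finset.mem_erase, Preorder.frestrictLe_apply,
    Subtype.forall, Finset.mem_Iic, Nat.le_zero, forall_eq]
  tauto

lemma unvisited_past_eq_empty {Y : Finset V} {t : ℕ} {ω : ℕ → Stage V} :
    unvisited Y (past t ω) = ∅ ↔ ∀ y ∈ Y, ∃ s ≤ t, (ω s).pos = y := by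
  simp only [unvisited, past, Finset.filter_eq_empty_iff, Preorder.frestrictLe_apply,
    Subtype.forall, Finset.mem_Iic, not_forall, not_not, exists_prop]

/-- Each time at which some target is still missing contributes one. The cover time thus becomes a
series that can be integrated term by term. -/
lemma coverOf_le_tsum (Y : Finset V) (ω : ℕ → Stage V) :
    coverOf Y ω ≤ ∑' t, if unvisited Y (past t ω) = ∅ then (0 : ℝ≥0∞) else 1 := by
  classical
  by_cases h : ∃ t, unvisited Y (past t ω) = ∅
  · have h1 := Nat.find_spec h
    have h2 : ∀ s < Nat.find h, unvisited Y (past s ω) ≠ ∅ := fun s hs => Nat.find_min h hs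
    calc coverOf Y ω ≤ (Nat.find h : ℝ≥0∞) := iInf₂_le _ (unvisited_past_eq_empty.1 h1)
      _ = ∑ t ∈ Finset.range (Nat.find h),
            if unvisited Y (past t ω) = ∅ then (0 : ℝ≥0∞) else 1 := by
          rw [Finset.sum_congr rfl fun s hs => if_neg (h2 s (Finset.mem_range.1 hs))]
          simp
      _ ≤ _ := ENNReal.sum_le_tsum _
  · push Not at h
    have : (∑' t, if unvisited Y (past t ω) = ∅ then (0 : ℝ≥0∞) else 1) = ∞ := by
      rw [tsum_congr fun t => if_neg (h t).ne_empty]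
      exact ENNReal.tsum_const_eq_top_of_ne_zero one_ne_zero
    rw [this]; exact le_top

end Trajectories

/-! ### One-step disintegration of the trajectory measure. -/

section Law

variable {V : Type*} [Fintype V] {G : SimpleGraph V} [DecidableRel G.Adj]

lemma lintegral_walkLaw_succ (α : Strategy V) (v : V) (t : ℕ)
    (F : History V t × Stage V → ℝ≥0∞) (hF : Measurable F) :
    ∫⁻ ω, F (past t ω, ω (t + 1)) ∂(walkLaw G α v) =
      ∫⁻ ω, ∫⁻ s, F (past t ω, s) ∂(stepLaw G α t (past t ω)) ∂(walkLaw G α v) := by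
  have key := Kernel.map_frestrictLe_trajMeasure_compProd_eq_map_trajMeasure
    (X := fun _ => Stage V) (μ₀ := (arrive G v).toMeasure) (κ := stepKernel G α) (a := t)
  have h1 : ∫⁻ ω, F (past t ω, ω (t + 1)) ∂(walkLaw G α v) =
      ∫⁻ z, F z ∂((walkLaw G α v).map fun ω => (past t ω, ω (t + 1))) := by
    rw [lintegral_map hF ((measurable_past t).prodMk (measurable_pi_apply _))]
  have h2 : (walkLaw G α v).map (fun ω => (past t ω, ω (t + 1))) =
      (walkLaw G α v).map (past t) ⊗ₘ stepKernel G α t := key.symm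
  have : SFinite ((walkLaw G α v).map (past t)) := by
    unfold walkLaw; infer_instance
  rw [h1, h2, Measure.lintegral_compProd hF,
    lintegral_map (by exact Measurable.lintegral_kernel_prod_right' hF) (measurable_past t)]
  rfl

lemma lintegral_walkLaw_zero (α : Strategy V) (v : V) (g : Stage V → ℝ≥0∞) :
    ∫⁻ ω, g (ω 0) ∂(walkLaw G α v) = ∫⁻ s, g s ∂(arrive G v).toMeasure := by
  have hg : Measurable g := measurable_of_countable g
  have h : (walkLaw G α v).map (past 0) =
      (arrive G v).toMeasure.map
        (MeasurableEquiv.piUnique (fun _ : Finset.Iic 0 => Stage V)).symm := by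
    have h3 : (Kernel.traj (X := fun _ => Stage V) (stepKernel G α) 0).map
        (Preorder.frestrictLe (π := fun _ => Stage V) 0) = Kernel.id := by
      rw [Kernel.traj_map_frestrictLe, Kernel.partialTraj_self]
    have h4 : (past 0 : (ℕ → Stage V) → History V 0) =
      Preorder.frestrictLe (π := fun _ => Stage V) 0 := rfl
    rw [h4]
    unfold walkLaw Kernel.trajMeasure
    rw [Measure.map_comp _ _ (Preorder.measurable_frestrictLe 0), h3, Measure.id_comp]
  have h1 : ∫⁻ ω, g (ω 0) ∂(walkLaw G α v) =
      ∫⁻ h : History V 0, g h.last ∂((walkLaw G α v).map (past 0)) := by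
    rw [lintegral_map (measurable_of_countable _) (measurable_past 0)]; rfl
  rw [h1, h, lintegral_map (measurable_of_countable _) (MeasurableEquiv.measurable _)]
  refine lintegral_congr fun s => ?_
  rfl

end Law

/-! ### From potentials to strategies. -/

section Verification

variable {V : Type*} [Fintype V] [DecidableEq V] (G : SimpleGraph V) [DecidableRel G.Adj]

/-- A choice rule: at time `t`, with unvisited set `S`, whether the first of two offers is taken. -/
abbrev Rule (V : Type*) : Type _ := ℕ → Finset V → V → V → Bool

/-- The vertex chosen by a rule. -/
def Rule.pick (b : Rule V) (t : ℕ) (S : Finset V) (c : V × V) : V :=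
  if b t S c.1 c.2 then c.1 else c.2

/-- The strategy that tries to visit `Y` by following a rule. -/
noncomputable def Rule.strategy (b : Rule V) (Y : Finset V) : Strategy V := fun t h =>
  if b t (unvisited Y h) h.last.offer₁ h.last.offer₂ then 1 else 0

lemma stepLaw_strategy (b : Rule V) (Y : Finset V) (t : ℕ) (h : History V t) :
    stepLaw G (b.strategy Y) t h =
      (arrive G (b.pick t (unvisited Y h) (h.last.offer₁, h.last.offer₂))).toMeasure := by
  unfold stepLaw Rule.strategy Rule.pick
  by_cases hb : b t (unvisited Y h) h.last.offer₁ h.last.offer₂ <;> simp [hb]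

/-- The remaining cost after the stage `s` has been observed, for a potential `W`. -/
noncomputable def stageCost (b : Rule V) (W : ℕ → Finset V → V → ℝ) (t : ℕ) (S : Finset V)
    (s : Stage V) : ℝ≥0∞ :=
  if S = ∅ then 0 else
    1 + ENNReal.ofReal (W (t + 1) (S.erase (b.pick t S (s.offer₁, s.offer₂)))
      (b.pick t S (s.offer₁, s.offer₂)))

variable {G}

/-- This is `hstep` rewritten as an integral over the offers at `x`. For `S = ∅` the cost is zero by
definition, so nothing is asked of `W` there beyond nonnegativity. -/
lemma lintegral_stageCost_le (hG : ∀ x, 0 < G.degree x) {b : Rule V} {W : ℕ → Finset V → V → ℝ}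
    (hW : ∀ t S x, 0 ≤ W t S x)
    (hstep : ∀ t S x, S.Nonempty → x ∉ S →
      1 + (∑ c ∈ offers G x, W (t + 1) (S.erase (b.pick t S c)) (b.pick t S c)) /
        (G.degree x : ℝ) ^ 2 ≤ W t S x)
    (t : ℕ) (S : Finset V) (x : V) (hx : x ∉ S) :
    ∫⁻ s, stageCost b W t S s ∂(arrive G x).toMeasure ≤ ENNReal.ofReal (W t S x) := by
  rcases S.eq_empty_or_nonempty with rfl | hS
  · simp [stageCost]
  have hd : (0 : ℝ) < (G.degree x : ℝ) ^ 2 := by have := hG x; positivity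
  have hcard : ((offers G x).card : ℝ≥0∞) = ENNReal.ofReal ((G.degree x : ℝ) ^ 2) := by
    rw [card_offers, ← ENNReal.ofReal_natCast]; push_cast; rfl
  have hc0 : ((offers G x).card : ℝ≥0∞) ≠ 0 := by
    rw [hcard]; simpa only [ne_eq, ENNReal.ofReal_eq_zero, not_le] using hd
  rw [lintegral_arrive G (hG x)]
  simp only [stageCost, hS.ne_empty, if_false]
  rw [Finset.sum_add_distrib, mul_add, Finset.sum_const, nsmul_eq_mul, mul_one,
    ENNReal.inv_mul_cancel hc0 (ENNReal.natCast_ne_top _), hcard,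
    ← ENNReal.ofReal_sum_of_nonneg (fun c _ => hW _ _ _), ← ENNReal.ofReal_inv_of_pos hd,
    ← ENNReal.ofReal_mul (by positivity), ← ENNReal.ofReal_one,
    ← ENNReal.ofReal_add zero_le_one
      (mul_nonneg (by positivity) (Finset.sum_nonneg fun c _ => hW _ _ _))]
  refine ENNReal.ofReal_le_ofReal (le_trans (le_of_eq ?_) (hstep t S x hS hx))
  simp only [Prod.mk.eta]
  ring

/-- A potential that decreases by one in expectation at each step bounds the expected time
to visit all of `Y`. -/
theorem exists_strategy_lintegral_coverOf_le (hG : ∀ x, 0 < G.degree x) (b : Rule V)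
    {W : ℕ → Finset V → V → ℝ} (hW : ∀ t S x, 0 ≤ W t S x)
    (hstep : ∀ t S x, S.Nonempty → x ∉ S →
      1 + (∑ c ∈ offers G x, W (t + 1) (S.erase (b.pick t S c)) (b.pick t S c)) /
        (G.degree x : ℝ) ^ 2 ≤ W t S x)
    (Y : Finset V) (v : V) :
    ∃ α : Strategy V, ∫⁻ ω, coverOf Y ω ∂(walkLaw G α v) ≤
      ENNReal.ofReal (W 0 (Y.erase v) v) := by
  classical
  refine ⟨b.strategy Y, ?_⟩
  set μ := walkLaw G (b.strategy Y) v with hμ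
  let live : ℕ → (ℕ → Stage V) → ℝ≥0∞ := fun t ω =>
    if unvisited Y (past t ω) = ∅ then 0 else 1
  let cost : ℕ → (ℕ → Stage V) → ℝ≥0∞ := fun t ω =>
    stageCost b W t (unvisited Y (past t ω)) (ω t)
  have hlive : ∀ t, Measurable (live t) := fun t =>
    (measurable_of_countable (fun h : History V t =>
      if unvisited Y h = ∅ then (0 : ℝ≥0∞) else 1)).comp (measurable_past t)
  have h0 : ∫⁻ ω, cost 0 ω ∂μ ≤ ENNReal.ofReal (W 0 (Y.erase v) v) := by
    simp only [cost, unvisited_past_zero]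
    rw [hμ, lintegral_walkLaw_zero (G := G) (b.strategy Y) v
      (fun s => stageCost b W 0 (Y.erase s.pos) s), lintegral_arrive G (hG v)]
    have := lintegral_stageCost_le hG hW hstep 0 (Y.erase v) v (by simp)
    rwa [lintegral_arrive G (hG v)] at this
  -- The cost includes the potential at the vertex about to be entered. Integrating out the next
  -- pair of offers at that vertex leaves the potential, and the remaining `1` pays for `live t`;
  -- these inequalities telescope.
  have hsucc : ∀ t, ∫⁻ ω, live t ω ∂μ + ∫⁻ ω, cost (t + 1) ω ∂μ ≤ ∫⁻ ω, cost t ω ∂μ := by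
    intro t
    have e1 : ∫⁻ ω, cost (t + 1) ω ∂μ =
        ∫⁻ ω, ∫⁻ s, stageCost b W (t + 1) ((unvisited Y (past t ω)).erase s.pos) s
          ∂(stepLaw G (b.strategy Y) t (past t ω)) ∂μ := by
      simp only [cost, unvisited_past_succ]
      exact lintegral_walkLaw_succ (G := G) (b.strategy Y) v t
        (fun z => stageCost b W (t + 1) ((unvisited Y z.1).erase z.2.pos) z.2)
        (measurable_of_countable _)
    rw [e1, ← lintegral_add_left (hlive t)]
    refine lintegral_mono fun ω => ?_
    rw [stepLaw_strategy]
    simp only [live, cost]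
    set S := unvisited Y (past t ω)
    have hlast : (past t ω).last = ω t := rfl
    rw [hlast]
    set x := b.pick t S ((ω t).offer₁, (ω t).offer₂) with hx
    by_cases hS : S = ∅
    · simp [hS, stageCost]
    · rw [if_neg hS]
      unfold stageCost
      rw [if_neg hS, ← hx]
      refine add_le_add le_rfl ?_
      have := lintegral_stageCost_le hG hW hstep (t + 1) (S.erase x) x (by simp)
      rw [lintegral_arrive G (hG x)] at this ⊢
      exact this
  have hsum : ∀ t, ∑ s ∈ Finset.range t, ∫⁻ ω, live s ω ∂μ + ∫⁻ ω, cost t ω ∂μ ≤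
      ENNReal.ofReal (W 0 (Y.erase v) v) := by
    intro t
    induction t with
    | zero => simpa using h0
    | succ t ih =>
      rw [Finset.sum_range_succ, add_assoc]
      exact (add_le_add le_rfl (hsucc t)).trans ih
  calc ∫⁻ ω, coverOf Y ω ∂μ ≤ ∫⁻ ω, ∑' t, live t ω ∂μ :=
        lintegral_mono fun ω => coverOf_le_tsum Y ω
    _ = ∑' t, ∫⁻ ω, live t ω ∂μ := lintegral_tsum fun t => (hlive t).aemeasurable
    _ ≤ _ := by
        rw [ENNReal.tsum_eq_iSup_nat]
        exact iSup_le fun t => le_self_add.trans (hsum t)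

end Verification

/-! ### Neighbour averages as self-adjoint operators. -/

section Averaging

variable {V : Type*} [Fintype V] (G : SimpleGraph V) [DecidableRel G.Adj]

/-- The average of `f` over the neighbours of `x`. -/
noncomputable def nbrAvg (f : V → ℝ) (x : V) : ℝ := (∑ y ∈ G.neighborFinset x, f y) / G.degree x

/-- One step of the lazy random walk applied to `f`. -/
noncomputable def lazyAvg (f : V → ℝ) (x : V) : ℝ := (f x + nbrAvg G f x) / 2

/-- The inner product weighted by the degrees. -/
noncomputable def degInner (f g : V → ℝ) : ℝ := ∑ x, (G.degree x : ℝ) * (f x * g x)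

lemma sum_neighborFinset_swap (F : V → V → ℝ) :
    ∑ x, ∑ y ∈ G.neighborFinset x, F x y = ∑ x, ∑ y ∈ G.neighborFinset x, F y x := by
  refine Finset.sum_comm' fun x y => ?_
  simp [G.adj_comm]

variable {G}

lemma degree_mul_nbrAvg (hG : ∀ x, 0 < G.degree x) (f : V → ℝ) (x : V) :
    (G.degree x : ℝ) * nbrAvg G f x = ∑ y ∈ G.neighborFinset x, f y :=
  mul_div_cancel₀ _ (by exact_mod_cast (hG x).ne')

lemma sum_neighborFinset_const (c : ℝ) (x : V) :
    ∑ _y ∈ G.neighborFinset x, c = G.degree x * c := by simp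

lemma degInner_nbrAvg (hG : ∀ x, 0 < G.degree x) (f g : V → ℝ) :
    degInner G f (nbrAvg G g) = ∑ x, ∑ y ∈ G.neighborFinset x, f x * g y := by
  refine Finset.sum_congr rfl fun x _ => ?_
  rw [mul_left_comm, degree_mul_nbrAvg hG, Finset.mul_sum]

lemma degInner_nbrAvg_comm (hG : ∀ x, 0 < G.degree x) (f g : V → ℝ) :
    degInner G f (nbrAvg G g) = degInner G (nbrAvg G f) g := by
  have h : degInner G (nbrAvg G f) g = degInner G g (nbrAvg G f) := by
    simp [degInner, mul_comm]
  rw [h, degInner_nbrAvg hG, degInner_nbrAvg hG, sum_neighborFinset_swap]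
  simp only [mul_comm]

lemma degInner_self_nonneg (f : V → ℝ) : 0 ≤ degInner G f f :=
  Finset.sum_nonneg fun _ _ => mul_nonneg (Nat.cast_nonneg _) (mul_self_nonneg _)

lemma sum_sum_sq (f : V → ℝ) :
    ∑ x, ∑ _ ∈ G.neighborFinset x, f x ^ 2 = degInner G f f := by
  refine Finset.sum_congr rfl fun x _ => ?_
  rw [sum_neighborFinset_const, sq]

lemma degInner_nbrAvg_self_le (hG : ∀ x, 0 < G.degree x) (f : V → ℝ) :
    degInner G f (nbrAvg G f) ≤ degInner G f f := by
  have h1 : ∑ x, ∑ y ∈ G.neighborFinset x, f y ^ 2 = degInner G f f := by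
    rw [← sum_neighborFinset_swap G fun z _ => f z ^ 2]; exact sum_sum_sq f
  have h : ∑ x, ∑ y ∈ G.neighborFinset x, f x * f y ≤
      ∑ x, ∑ y ∈ G.neighborFinset x, (f x ^ 2 / 2 + f y ^ 2 / 2) :=
    Finset.sum_le_sum fun x _ => Finset.sum_le_sum fun y _ => by nlinarith [sq_nonneg (f x - f y)]
  rw [degInner_nbrAvg hG]
  refine h.trans (le_of_eq ?_)
  simp only [Finset.sum_add_distrib, ← Finset.sum_div]
  rw [h1, sum_sum_sq]; ring

lemma degInner_lazyAvg (f g : V → ℝ) :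
    degInner G f (lazyAvg G g) = (degInner G f g + degInner G f (nbrAvg G g)) / 2 := by
  simp only [degInner, lazyAvg, ← Finset.sum_add_distrib, Finset.sum_div]
  exact Finset.sum_congr rfl fun x _ => by ring

lemma nbrAvg_const (hG : ∀ x, 0 < G.degree x) (c : ℝ) : nbrAvg G (fun _ => c) = fun _ => c := by
  ext x
  have : (G.degree x : ℝ) ≠ 0 := by exact_mod_cast (hG x).ne'
  rw [nbrAvg, sum_neighborFinset_const]; field_simp

lemma lazyAvg_const (hG : ∀ x, 0 < G.degree x) (c : ℝ) : lazyAvg G (fun _ => c) = fun _ => c := by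
  ext x
  rw [lazyAvg, nbrAvg_const hG]; ring

open Matrix in
lemma sqrt_dotProduct_sqrt (f g : V → ℝ) :
    (fun x => √(G.degree x) * f x) ⬝ᵥ (fun x => √(G.degree x) * g x) = degInner G f g := by
  refine Finset.sum_congr rfl fun x _ => ?_
  have := Real.mul_self_sqrt (Nat.cast_nonneg (α := ℝ) (G.degree x))
  linear_combination f x * g x * this

end Averaging

/-! ### The second eigenvalue and the Poincaré inequality. -/

section Spectral

open Matrix

variable {V : Type*} [Fintype V] [DecidableEq V]

lemma secondEigenvalue_eq_eigenvalues₀ {A : Matrix V V ℝ} (hA : A.IsHermitian)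
    (hV : 1 < Fintype.card V) : secondEigenvalue A = hA.eigenvalues₀ ⟨1, hV⟩ := by
  have h := hA.sort_roots_charpoly_eq_eigenvalues₀
  have h1 : A.charpoly.roots.map (RCLike.re : ℝ → ℝ) = A.charpoly.roots := by
    simp
  rw [h1] at h
  unfold secondEigenvalue
  have h2 : A.charpoly.roots.sort (fun a b => b ≤ a) = List.ofFn hA.eigenvalues₀ := h
  rw [h2]
  simp [List.getD_eq_getElem?_getD, hV]

lemma sum_eigenvectorBasis_dotProduct {A : Matrix V V ℝ} (hA : A.IsHermitian) (g h : V → ℝ) :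
    ∑ i, (⇑(hA.eigenvectorBasis i) ⬝ᵥ g) * (⇑(hA.eigenvectorBasis i) ⬝ᵥ h) = g ⬝ᵥ h := by
  have := hA.eigenvectorBasis.sum_inner_mul_inner (WithLp.toLp 2 g) (WithLp.toLp 2 h)
  simp only [EuclideanSpace.inner_eq_star_dotProduct, star_trivial] at this
  rw [dotProduct_comm g h, ← this]
  exact Finset.sum_congr rfl fun i _ => by rw [dotProduct_comm h]

lemma eigenvectorBasis_dotProduct_mulVec {A : Matrix V V ℝ} (hA : A.IsHermitian) (g : V → ℝ)
    (i : V) : ⇑(hA.eigenvectorBasis i) ⬝ᵥ (A *ᵥ g) =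
      hA.eigenvalues i * (⇑(hA.eigenvectorBasis i) ⬝ᵥ g) := by
  have hT : Aᵀ = A := by simpa using hA.eq
  rw [dotProduct_mulVec, ← mulVec_transpose, hT, hA.mulVec_eigenvectorBasis, smul_dotProduct,
    smul_eq_mul]

lemma eigenvectorBasis_dotProduct_self {A : Matrix V V ℝ} (hA : A.IsHermitian) (i : V) :
    (⇑(hA.eigenvectorBasis i) ⬝ᵥ ⇑(hA.eigenvectorBasis i) : ℝ) = 1 := by
  have := real_inner_self_eq_norm_sq (hA.eigenvectorBasis i)
  rw [hA.eigenvectorBasis.orthonormal.1 i, EuclideanSpace.inner_eq_star_dotProduct] at this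
  simpa using this

lemma secondEigenvalue_le_one_of_contraction {A : Matrix V V ℝ} (hA : A.IsHermitian)
    (hV : 1 < Fintype.card V) (hle : ∀ f : V → ℝ, f ⬝ᵥ (A *ᵥ f) ≤ f ⬝ᵥ f) :
    secondEigenvalue A ≤ 1 := by
  have key : ∀ i, hA.eigenvalues i ≤ 1 := fun i => by
    have := hle ⇑(hA.eigenvectorBasis i)
    rwa [eigenvectorBasis_dotProduct_mulVec, eigenvectorBasis_dotProduct_self, mul_one] at this
  rw [secondEigenvalue_eq_eigenvalues₀ hA hV]
  have := key (Fintype.equivOfCardEq (Fintype.card_fin _) ⟨1, hV⟩)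
  simpa [IsHermitian.eigenvalues] using this

/-- If the second eigenvalue is at least `1`, contraction suffices. Otherwise every eigenvector
except the top one has eigenvalue below `1`, hence is orthogonal to the fixed vector `e`. So `e`
spans the top direction, `g` has no component there, and all other eigenvalues are at most the
second. -/
lemma dotProduct_mulVec_le_secondEigenvalue {A : Matrix V V ℝ} (hA : A.IsHermitian)
    (hV : 1 < Fintype.card V) (hle : ∀ f : V → ℝ, f ⬝ᵥ (A *ᵥ f) ≤ f ⬝ᵥ f)
    {e : V → ℝ} (he0 : e ≠ 0) (he : A *ᵥ e = e) {g : V → ℝ} (hg : g ⬝ᵥ e = 0) :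
    g ⬝ᵥ (A *ᵥ g) ≤ secondEigenvalue A * (g ⬝ᵥ g) := by
  set lam := secondEigenvalue A with hlam
  set v : V → V → ℝ := fun i => ⇑(hA.eigenvectorBasis i) with hv
  have hgg : 0 ≤ g ⬝ᵥ g := by
    simpa [dotProduct] using Finset.sum_nonneg fun i _ => mul_self_nonneg (g i)
  rcases le_or_gt 1 lam with h1 | h1
  · exact (hle g).trans (by nlinarith)
  set φ : Fin (Fintype.card V) ≃ V := Fintype.equivOfCardEq (Fintype.card_fin _) with hφ
  set i₀ := φ ⟨0, by omega⟩ with hi₀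
  have hsmall : ∀ i, i ≠ i₀ → hA.eigenvalues i ≤ lam := by
    intro i hi
    rw [hlam, secondEigenvalue_eq_eigenvalues₀ hA hV]
    refine hA.eigenvalues₀_antitone ?_
    rw [Fin.le_def]
    have : φ.symm i ≠ ⟨0, by omega⟩ := fun h => hi (by rw [hi₀, ← h, φ.apply_symm_apply])
    have h2 : (φ.symm i).1 ≠ 0 := fun h => this (Fin.ext h)
    exact Nat.one_le_iff_ne_zero.2 h2
  have horth : ∀ i, i ≠ i₀ → v i ⬝ᵥ e = 0 := by
    intro i hi
    have h := eigenvectorBasis_dotProduct_mulVec hA e i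
    rw [he] at h
    have h3 : (1 - hA.eigenvalues i) * (v i ⬝ᵥ e) = 0 := by
      simp only [hv]; linarith
    rcases mul_eq_zero.1 h3 with h4 | h4
    · linarith [hsmall i hi]
    · exact h4
  have hee := sum_eigenvectorBasis_dotProduct hA e e
  have hge := sum_eigenvectorBasis_dotProduct hA g e
  rw [Finset.sum_eq_single i₀ (fun i _ hi => by
    have := horth i hi; simp only [hv] at this; rw [this, mul_zero]) (by simp)] at hee hge
  have he1 : v i₀ ⬝ᵥ e ≠ 0 := by
    intro h
    simp only [hv] at h
    rw [h, mul_zero] at hee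
    exact he0 (dotProduct_self_eq_zero.1 hee.symm)
  have hg0 : v i₀ ⬝ᵥ g = 0 := by
    rw [hg] at hge
    exact (mul_eq_zero.1 hge).resolve_right he1
  rw [← sum_eigenvectorBasis_dotProduct hA g (A *ᵥ g), ← sum_eigenvectorBasis_dotProduct hA g g,
    Finset.mul_sum]
  refine Finset.sum_le_sum fun i _ => ?_
  rw [eigenvectorBasis_dotProduct_mulVec]
  by_cases hi : i = i₀
  · subst hi
    simp only [hv] at hg0
    rw [hg0]; simp
  · have := hsmall i hi
    nlinarith [mul_self_nonneg (⇑(hA.eigenvectorBasis i) ⬝ᵥ g)]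

variable (G : SimpleGraph V) [DecidableRel G.Adj]

/-- The lazy walk matrix, conjugated by the square roots of the degrees so as to be symmetric. -/
noncomputable def symLazyMatrix : Matrix V V ℝ :=
  Matrix.of fun x y => ((if x = y then 1 else 0) +
    if G.Adj x y then 1 / (√(G.degree x) * √(G.degree y)) else 0) / 2

lemma symLazyMatrix_isHermitian : (symLazyMatrix G).IsHermitian := by
  ext x y
  simp [symLazyMatrix, G.adj_comm, eq_comm, mul_comm]

variable {G}

/-- Multiplication by `√deg` carries `degInner` to the ordinary dot product and `lazyAvg` to a
symmetric matrix, so the spectral theorem for symmetric matrices applies to the walk. -/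
lemma symLazyMatrix_mulVec (hG : ∀ x, 0 < G.degree x) (f : V → ℝ) (x : V) :
    (symLazyMatrix G *ᵥ fun y => √(G.degree y) * f y) x = √(G.degree x) * lazyAvg G f x := by
  have hs : ∀ x, √(G.degree x : ℝ) ≠ 0 := fun x =>
    (Real.sqrt_pos.2 (by exact_mod_cast hG x)).ne'
  have hsq : ∀ x, √(G.degree x : ℝ) * √(G.degree x : ℝ) = G.degree x := fun x =>
    Real.mul_self_sqrt (Nat.cast_nonneg _)
  have hsum : ∑ y, (if G.Adj x y then 1 / (√(G.degree x) * √(G.degree y)) else 0) *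
      (√(G.degree y) * f y) = (∑ y ∈ G.neighborFinset x, f y) / √(G.degree x) := by
    rw [Finset.sum_div, SimpleGraph.neighborFinset_eq_filter, Finset.sum_filter]
    refine Finset.sum_congr rfl fun y _ => ?_
    split_ifs
    · have := hs x; have := hs y
      field_simp
    · simp
  have hsplit : (symLazyMatrix G *ᵥ fun y => √(G.degree y) * f y) x =
      (∑ y, (if x = y then 1 else 0) * (√(G.degree y) * f y) +
        ∑ y, (if G.Adj x y then 1 / (√(G.degree x) * √(G.degree y)) else 0) *
          (√(G.degree y) * f y)) / 2 := by
    rw [← Finset.sum_add_distrib, Finset.sum_div]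
    refine Finset.sum_congr rfl fun y _ => ?_
    simp only [symLazyMatrix, Matrix.of_apply]
    ring
  rw [hsplit, hsum]
  simp only [ite_mul, one_mul, zero_mul, Finset.sum_ite_eq, Finset.mem_univ, if_true]
  have h1 : (∑ y ∈ G.neighborFinset x, f y) / √(G.degree x) =
      √(G.degree x) * nbrAvg G f x := by
    rw [div_eq_iff (hs x), mul_right_comm, hsq, degree_mul_nbrAvg hG]
  rw [h1, lazyAvg]
  ring

/-- The two matrices are conjugate by a diagonal one. Since `secondEigenvalue` depends only on the
characteristic polynomial, it may be computed on the symmetric side. -/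
lemma lazyWalkMatrix_charpoly (hG : ∀ x, 0 < G.degree x) :
    (lazyWalkMatrix G).charpoly = (symLazyMatrix G).charpoly := by
  have hs : ∀ x, √(G.degree x : ℝ) ≠ 0 := fun x =>
    (Real.sqrt_pos.2 (by exact_mod_cast hG x)).ne'
  have hsq : ∀ x, √(G.degree x : ℝ) * √(G.degree x : ℝ) = G.degree x := fun x =>
    Real.mul_self_sqrt (Nat.cast_nonneg _)
  let U : (Matrix V V ℝ)ˣ :=
    ⟨Matrix.diagonal fun x => (√(G.degree x : ℝ))⁻¹, Matrix.diagonal fun x => √(G.degree x : ℝ),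
      by rw [Matrix.diagonal_mul_diagonal]; simp [hs],
      by rw [Matrix.diagonal_mul_diagonal]; simp [hs]⟩
  have : lazyWalkMatrix G = U.val * symLazyMatrix G * U⁻¹.val := by
    ext x y
    change _ = (Matrix.diagonal (fun x => (√(G.degree x : ℝ))⁻¹) * symLazyMatrix G *
      Matrix.diagonal fun x => √(G.degree x : ℝ)) x y
    rw [Matrix.mul_diagonal, Matrix.diagonal_mul]
    have := hs x; have := hs y
    by_cases hxy : x = y
    · subst hxy
      simp only [lazyWalkMatrix, walkMatrix, symLazyMatrix, Matrix.smul_apply, Matrix.add_apply,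
        Matrix.one_apply, Matrix.of_apply, if_true, G.irrefl, if_false, smul_eq_mul]
      field_simp
    · by_cases hadj : G.Adj x y
      · simp only [lazyWalkMatrix, walkMatrix, symLazyMatrix, Matrix.smul_apply, Matrix.add_apply,
          Matrix.one_apply, Matrix.of_apply, if_true, if_neg hxy, hadj, smul_eq_mul]
        rw [show (1 : ℝ) / (G.degree x : ℝ) = 1 / (√(G.degree x) * √(G.degree x)) by rw [hsq x]]
        field_simp
        ring
      · simp [lazyWalkMatrix, walkMatrix, symLazyMatrix, hxy, hadj]
  rw [this, Matrix.coe_units_inv, Matrix.charpoly_units_conj]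

lemma secondEigenvalue_lazyWalkMatrix (hG : ∀ x, 0 < G.degree x) :
    secondEigenvalue (lazyWalkMatrix G) = secondEigenvalue (symLazyMatrix G) := by
  rw [secondEigenvalue, lazyWalkMatrix_charpoly hG, secondEigenvalue]

lemma symLazyMatrix_contraction (hG : ∀ x, 0 < G.degree x) (f : V → ℝ) :
    f ⬝ᵥ (symLazyMatrix G *ᵥ f) ≤ f ⬝ᵥ f := by
  have hs : ∀ x, √(G.degree x : ℝ) ≠ 0 := fun x =>
    (Real.sqrt_pos.2 (by exact_mod_cast hG x)).ne'
  obtain ⟨g, rfl⟩ : ∃ g : V → ℝ, f = fun x => √(G.degree x) * g x :=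
    ⟨fun x => f x / √(G.degree x), by ext x; have := hs x; field_simp⟩
  rw [funext (symLazyMatrix_mulVec hG g), sqrt_dotProduct_sqrt, sqrt_dotProduct_sqrt,
    degInner_lazyAvg]
  linarith [degInner_nbrAvg_self_le hG g]

lemma secondEigenvalue_le_one (hG : ∀ x, 0 < G.degree x) (hV : 1 < Fintype.card V) :
    secondEigenvalue (lazyWalkMatrix G) ≤ 1 := by
  rw [secondEigenvalue_lazyWalkMatrix hG]
  exact secondEigenvalue_le_one_of_contraction (symLazyMatrix_isHermitian G) hV
    (symLazyMatrix_contraction hG)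

/-- The Poincaré inequality: on functions of mean zero the lazy walk has Rayleigh quotient at most
the second eigenvalue. -/
theorem degInner_lazyAvg_self_le (hG : ∀ x, 0 < G.degree x) (hV : 1 < Fintype.card V)
    {f : V → ℝ} (hf : degInner G f (fun _ => 1) = 0) :
    degInner G f (lazyAvg G f) ≤ secondEigenvalue (lazyWalkMatrix G) * degInner G f f := by
  rw [secondEigenvalue_lazyWalkMatrix hG]
  have h := dotProduct_mulVec_le_secondEigenvalue (symLazyMatrix_isHermitian G) hV
    (symLazyMatrix_contraction hG) (e := fun x => √(G.degree x) * (1 : ℝ))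
    (g := fun x => √(G.degree x) * f x) ?_ ?_ ?_
  · rwa [funext (symLazyMatrix_mulVec hG f), sqrt_dotProduct_sqrt, sqrt_dotProduct_sqrt] at h
  · have : Nonempty V := Fintype.card_pos_iff.1 (by omega)
    intro h
    have h0 := congrFun h (Classical.arbitrary V)
    simp only [mul_one, Pi.zero_apply] at h0
    exact (Real.sqrt_pos.2 (by exact_mod_cast hG _)).ne' h0
  · rw [funext (symLazyMatrix_mulVec hG fun _ => (1 : ℝ)), lazyAvg_const hG]
  · rw [sqrt_dotProduct_sqrt, hf]

end Spectral

/-! ### Consequences of the spectral gap: mixing and hitting potentials. -/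

section Mixing

variable {V : Type*} [Fintype V] {G : SimpleGraph V} [DecidableRel G.Adj]

variable (G) in
/-- The spectral gap inequality: the lazy walk has Rayleigh quotient at most `1 - γ` on functions
of mean zero. -/
def HasGap (γ : ℝ) : Prop :=
  ∀ f : V → ℝ, degInner G f (fun _ => 1) = 0 →
    degInner G f (lazyAvg G f) ≤ (1 - γ) * degInner G f f

lemma degInner_comm (f g : V → ℝ) : degInner G f g = degInner G g f := by
  simp [degInner, mul_comm]

lemma degInner_nbrAvg_nbrAvg_le (hG : ∀ x, 0 < G.degree x) (f : V → ℝ) :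
    degInner G (nbrAvg G f) (nbrAvg G f) ≤ degInner G f f := by
  have h1 : ∑ x, ∑ y ∈ G.neighborFinset x, f y ^ 2 = degInner G f f := by
    rw [← sum_neighborFinset_swap G fun z _ => f z ^ 2]; exact sum_sum_sq f
  rw [← h1]
  refine Finset.sum_le_sum fun x _ => ?_
  have hd : (0 : ℝ) < G.degree x := by exact_mod_cast hG x
  have h := sq_sum_le_card_mul_sum_sq (s := G.neighborFinset x) (f := f)
  rw [SimpleGraph.card_neighborFinset_eq_degree] at h
  have h2 : (G.degree x : ℝ) * (nbrAvg G f x * nbrAvg G f x) =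
      (∑ y ∈ G.neighborFinset x, f y) ^ 2 / G.degree x := by
    rw [nbrAvg]; field_simp
  rw [h2, div_le_iff₀ hd, mul_comm]
  exact h

/-- Laziness puts the spectrum in `[0, 1]`, where `λ² ≤ λ`. Thus a one-sided gap already contracts
the norm, without control of eigenvalues near `-1` of the simple walk. The proof expands the square
and uses that `nbrAvg` is a contraction. -/
lemma degInner_lazyAvg_lazyAvg_le (hG : ∀ x, 0 < G.degree x) (f : V → ℝ) :
    degInner G (lazyAvg G f) (lazyAvg G f) ≤ degInner G f (lazyAvg G f) := by
  have h := degInner_nbrAvg_nbrAvg_le hG f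
  have h1 : degInner G (lazyAvg G f) (lazyAvg G f) =
      (degInner G f f + 2 * degInner G f (nbrAvg G f) +
        degInner G (nbrAvg G f) (nbrAvg G f)) / 4 := by
    simp only [degInner, lazyAvg, Finset.mul_sum, ← Finset.sum_add_distrib, Finset.sum_div]
    exact Finset.sum_congr rfl fun x _ => by ring
  rw [h1, degInner_lazyAvg]
  linarith

lemma degInner_nbrAvg_one (hG : ∀ x, 0 < G.degree x) (f : V → ℝ) :
    degInner G (nbrAvg G f) (fun _ => 1) = degInner G f (fun _ => 1) := by
  rw [← degInner_nbrAvg_comm hG, nbrAvg_const hG]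

lemma degInner_lazyAvg_one (hG : ∀ x, 0 < G.degree x) (f : V → ℝ) :
    degInner G (lazyAvg G f) (fun _ => 1) = degInner G f (fun _ => 1) := by
  rw [degInner_comm, degInner_lazyAvg, degInner_comm, degInner_comm _ (nbrAvg G f),
    degInner_nbrAvg_one hG]
  ring

lemma degInner_iterate_lazyAvg_one (hG : ∀ x, 0 < G.degree x) (f : V → ℝ) (k : ℕ) :
    degInner G ((lazyAvg G)^[k] f) (fun _ => 1) = degInner G f (fun _ => 1) := by
  induction k with
  | zero => rfl
  | succ k ih => rw [Function.iterate_succ_apply', degInner_lazyAvg_one hG, ih]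

lemma HasGap.degInner_iterate_le (hG : ∀ x, 0 < G.degree x) {γ : ℝ} (hγ : HasGap G γ)
    (hγ1 : γ ≤ 1) {f : V → ℝ} (hf : degInner G f (fun _ => 1) = 0) (k : ℕ) :
    degInner G ((lazyAvg G)^[k] f) ((lazyAvg G)^[k] f) ≤ (1 - γ) ^ k * degInner G f f := by
  induction k with
  | zero => simp
  | succ k ih =>
    rw [Function.iterate_succ_apply', pow_succ', mul_assoc]
    refine (degInner_lazyAvg_lazyAvg_le hG _).trans ((hγ _ ?_).trans ?_)
    · rw [degInner_iterate_lazyAvg_one hG, hf]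
    · exact mul_le_mul_of_nonneg_left ih (by linarith)

lemma sq_le_degInner_self (hG : ∀ x, 0 < G.degree x) (f : V → ℝ) (x : V) :
    f x ^ 2 ≤ degInner G f f := by
  have h1 : (1 : ℝ) ≤ G.degree x := by exact_mod_cast hG x
  calc f x ^ 2 ≤ (G.degree x : ℝ) * (f x * f x) := by nlinarith [mul_self_nonneg (f x)]
    _ ≤ _ := Finset.single_le_sum (f := fun x => (G.degree x : ℝ) * (f x * f x))
      (fun y _ => mul_nonneg (Nat.cast_nonneg _) (mul_self_nonneg _)) (Finset.mem_univ x)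

lemma nbrAvg_add_const (hG : ∀ x, 0 < G.degree x) (f : V → ℝ) (c : ℝ) (x : V) :
    nbrAvg G (fun y => f y + c) x = nbrAvg G f x + c := by
  have h : (G.degree x : ℝ) ≠ 0 := by exact_mod_cast (hG x).ne'
  rw [nbrAvg, Finset.sum_add_distrib, sum_neighborFinset_const, nbrAvg]
  field_simp

lemma iterate_lazyAvg_add_const (hG : ∀ x, 0 < G.degree x) (f : V → ℝ) (c : ℝ) (k : ℕ) :
    (lazyAvg G)^[k] (fun y => f y + c) = fun x => (lazyAvg G)^[k] f x + c := by
  induction k with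
  | zero => rfl
  | succ k ih =>
    rw [Function.iterate_succ_apply', Function.iterate_succ_apply', ih]
    ext x
    rw [lazyAvg, nbrAvg_add_const hG, lazyAvg]
    ring

lemma nbrAvg_mono {f g : V → ℝ} (h : ∀ x, f x ≤ g x) (x : V) : nbrAvg G f x ≤ nbrAvg G g x :=
  div_le_div_of_nonneg_right (Finset.sum_le_sum fun y _ => h y) (Nat.cast_nonneg _)

lemma nbrAvg_const_mul (c : ℝ) (f : V → ℝ) (x : V) :
    nbrAvg G (fun y => c * f y) x = c * nbrAvg G f x := by
  rw [nbrAvg, ← Finset.mul_sum, mul_div_assoc, nbrAvg]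

lemma iterate_lazyAvg_mem_Icc (hG : ∀ x, 0 < G.degree x) {f : V → ℝ}
    (hf : ∀ x, f x ∈ Set.Icc (0 : ℝ) 1) (k : ℕ) (x : V) :
    (lazyAvg G)^[k] f x ∈ Set.Icc (0 : ℝ) 1 := by
  induction k generalizing x with
  | zero => exact hf x
  | succ k ih =>
    rw [Function.iterate_succ_apply']
    have h0 := nbrAvg_mono (G := G) (f := fun _ => 0) (fun y => (ih y).1) x
    have h1 := nbrAvg_mono (G := G) (g := fun _ => 1) (fun y => (ih y).2) x
    rw [nbrAvg_const hG] at h0 h1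
    have := ih x
    simp only [Set.mem_Icc, lazyAvg] at *
    constructor <;> linarith

lemma degInner_one_le {D : ℕ} (hD : ∀ x, G.degree x ≤ D) :
    degInner G (fun _ => 1) (fun _ => 1) ≤ D * Fintype.card V := by
  simp only [degInner, mul_one]
  calc ∑ x, (G.degree x : ℝ) ≤ ∑ _x : V, (D : ℝ) :=
        Finset.sum_le_sum fun x _ => by exact_mod_cast hD x
    _ = _ := by simp [mul_comm]

lemma degInner_one_pos [Nonempty V] (hG : ∀ x, 0 < G.degree x) :
    0 < degInner G (fun _ => 1) (fun _ => 1) := by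
  simp only [degInner, mul_one]
  exact Finset.sum_pos (fun x _ => by exact_mod_cast hG x) Finset.univ_nonempty

/-- After mixing, the lazy walk is in `S` with probability at least a constant times the density
of `S`. -/
theorem HasGap.le_iterate_lazyAvg_indicator [DecidableEq V] (hG : ∀ x, 0 < G.degree x) {D : ℕ}
    (hD : ∀ x, G.degree x ≤ D) {γ : ℝ} (hγ : HasGap G γ) (hγ1 : γ ≤ 1) {k : ℕ}
    (hk : (1 - γ) ^ k * (4 * D ^ 3 * (Fintype.card V : ℝ) ^ 2) ≤ 1) (S : Finset V) (x : V) :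
    (S.card : ℝ) / (2 * D * Fintype.card V) ≤
      (lazyAvg G)^[k] (fun y => if y ∈ S then 1 else 0) x := by
  rcases S.eq_empty_or_nonempty with rfl | hS
  · simpa using (iterate_lazyAvg_mem_Icc hG (f := fun _ => 0) (by simp) k x).1
  have : Nonempty V := ⟨x⟩
  set n : ℝ := (Fintype.card V : ℝ) with hn
  have hn0 : 0 < n := by rw [hn]; exact_mod_cast Fintype.card_pos
  have hD0 : (0 : ℝ) < D := by exact_mod_cast (hG x).trans_le (hD x)
  set m := degInner G (fun _ => (1 : ℝ)) (fun _ => 1) with hm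
  have hm0 : 0 < m := degInner_one_pos hG
  have hmle : m ≤ D * n := degInner_one_le hD
  set s : ℝ := (S.card : ℝ) with hs
  have hs1 : 1 ≤ s := by rw [hs]; exact_mod_cast hS.card_pos
  set d : ℝ := ∑ y ∈ S, (G.degree y : ℝ) with hd
  have hd1 : s ≤ d := by
    calc s = ∑ _y ∈ S, (1 : ℝ) := by simp [hs]
      _ ≤ d := Finset.sum_le_sum fun y _ => by exact_mod_cast hG y
  have hd2 : d ≤ D * s := by
    calc d ≤ ∑ _y ∈ S, (D : ℝ) := Finset.sum_le_sum fun y _ => by exact_mod_cast hD y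
      _ = D * s := by simp [hs, mul_comm]
  set ind : V → ℝ := fun y => if y ∈ S then 1 else 0 with hind
  set f : V → ℝ := fun y => ind y - d / m with hf
  have hdi : ∀ c : ℝ, degInner G ind (fun _ => c) = d * c := by
    intro c
    simp only [degInner, hind, hd, ite_mul, one_mul, zero_mul, mul_ite, mul_zero,
      Finset.sum_ite_mem, Finset.univ_inter, Finset.sum_mul]
  have hii : degInner G ind ind = d := by
    simp [degInner, hind, hd]
  have hf1 : degInner G f (fun _ => 1) = 0 := by
    have : degInner G f (fun _ => 1) = degInner G ind (fun _ => 1) - d / m * m := by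
      simp only [degInner, hf, hm, Finset.mul_sum, ← Finset.sum_sub_distrib]
      exact Finset.sum_congr rfl fun y _ => by ring
    rw [this, hdi, div_mul_cancel₀ _ hm0.ne']; ring
  have hff : degInner G f f ≤ D * s := by
    have : degInner G f f = degInner G ind ind - 2 * (d / m) * degInner G ind (fun _ => 1) +
        (d / m) ^ 2 * m := by
      simp only [degInner, hf, hm, Finset.mul_sum, ← Finset.sum_sub_distrib,
        ← Finset.sum_add_distrib]
      exact Finset.sum_congr rfl fun y _ => by ring
    rw [this, hdi, hii]
    have h2 : (d / m) ^ 2 * m = d / m * d := by field_simp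
    have h3 : 0 ≤ d / m * d := by positivity
    rw [h2]; nlinarith
  have hk1 := hγ.degInner_iterate_le hG hγ1 hf1 k
  have hk2 := (sq_le_degInner_self hG ((lazyAvg G)^[k] f) x).trans hk1
  have hpow : 0 ≤ (1 - γ) ^ k := pow_nonneg (by linarith) k
  -- The mean `d / m` is at least `s / (Dn)`; the deviation is made at most half of that. The norm
  -- bound supplies only a multiple of `s`, and `s ≤ s ^ 2` because `S` is nonempty.
  have hk3 : ((lazyAvg G)^[k] f x) ^ 2 ≤ (s / (2 * D * n)) ^ 2 := by
    refine hk2.trans ((mul_le_mul_of_nonneg_left hff hpow).trans ?_)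
    rw [div_pow, le_div_iff₀ (by positivity)]
    calc (1 - γ) ^ k * (D * s) * (2 * D * n) ^ 2
        = (1 - γ) ^ k * (4 * D ^ 3 * n ^ 2) * s := by ring
      _ ≤ 1 * s := mul_le_mul_of_nonneg_right hk (by linarith)
      _ ≤ s ^ 2 := by nlinarith
  have hk4 := (abs_le_of_sq_le_sq' hk3 (by positivity)).1
  have hsum : ind = fun y => f y + d / m := by ext y; simp [hf]
  rw [hsum, iterate_lazyAvg_add_const hG]
  have hdm : s / (D * n) ≤ d / m := div_le_div₀ (by linarith) hd1 hm0 hmle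
  have : s / (D * n) = s / (2 * D * n) + s / (2 * D * n) := by field_simp; ring
  linarith

lemma HasGap.eq_zero_of_nbrAvg_eq {γ : ℝ} (hG : ∀ x, 0 < G.degree x) (hγ : HasGap G γ)
    (hγ0 : 0 < γ) {f : V → ℝ} (hf : degInner G f (fun _ => 1) = 0) (h : nbrAvg G f = f) :
    f = 0 := by
  have h1 := hγ f hf
  rw [degInner_lazyAvg, h] at h1
  have h2 : degInner G f f ≤ 0 := by nlinarith [degInner_self_nonneg (G := G) f]
  ext x
  have h3 := (sq_le_degInner_self hG f x).trans h2
  exact pow_eq_zero_iff two_ne_zero |>.1 (le_antisymm h3 (sq_nonneg _))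

/-- Adding the mean to `f - nbrAvg G f` removes the kernel of constants, so the resulting map `L` is
injective, hence surjective in finite dimension. A preimage of a mean-zero function has mean zero,
so the added term vanishes on it. -/
lemma HasGap.exists_poisson {γ : ℝ} (hG : ∀ x, 0 < G.degree x) (hγ : HasGap G γ)
    (hγ0 : 0 < γ) {g : V → ℝ} (hg : degInner G g (fun _ => 1) = 0) :
    ∃ h : V → ℝ, degInner G h (fun _ => 1) = 0 ∧ ∀ x, h x - nbrAvg G h x = g x := by
  let L : (V → ℝ) →ₗ[ℝ] (V → ℝ) :=
    { toFun := fun f x => f x - nbrAvg G f x + degInner G f (fun _ => 1)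
      map_add' := fun f g => by
        ext x
        simp only [nbrAvg, degInner, Pi.add_apply, Finset.sum_add_distrib, mul_one, mul_add]
        ring
      map_smul' := fun c f => by
        ext x
        simp only [nbrAvg, degInner, Pi.smul_apply, smul_eq_mul, mul_one, RingHom.id_apply,
          ← Finset.mul_sum, mul_left_comm]
        ring }
  have hmean : ∀ f, degInner G (L f) (fun _ => 1) =
      degInner G f (fun _ => 1) * degInner G (fun _ => 1) (fun _ => 1) := by
    intro f
    have : degInner G (L f) (fun _ => 1) = degInner G f (fun _ => 1) -
        degInner G (nbrAvg G f) (fun _ => 1) +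
        degInner G f (fun _ => 1) * degInner G (fun _ => 1) (fun _ => 1) := by
      have hc : ∀ c : ℝ, degInner G (fun x => f x - nbrAvg G f x + c) (fun _ => 1) =
          degInner G f (fun _ => 1) - degInner G (nbrAvg G f) (fun _ => 1) +
            c * degInner G (fun _ => 1) (fun _ => 1) := by
        intro c
        simp only [degInner, Finset.mul_sum, ← Finset.sum_sub_distrib, ← Finset.sum_add_distrib]
        exact Finset.sum_congr rfl fun x _ => by ring
      exact hc _
    rw [this, degInner_nbrAvg_one hG]; ring
  rcases isEmpty_or_nonempty V with hV | hV
  · exact ⟨0, by simp [degInner], fun x => hV.elim x⟩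
  have hm := degInner_one_pos hG
  have hzero : ∀ f, degInner G (L f) (fun _ => 1) = 0 → degInner G f (fun _ => 1) = 0 := by
    intro f hf
    rw [hmean] at hf
    exact (mul_eq_zero.1 hf).resolve_right hm.ne'
  have hinj : Function.Injective L := by
    rw [← LinearMap.ker_eq_bot, LinearMap.ker_eq_bot']
    intro f hf
    have h0 : degInner G f (fun _ => 1) = 0 := hzero f (by rw [hf]; simp [degInner])
    refine hγ.eq_zero_of_nbrAvg_eq hG hγ0 h0 ?_
    ext x
    have := congrFun hf x
    change f x - nbrAvg G f x + degInner G f (fun _ => 1) = 0 at this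
    linarith
  obtain ⟨h, hh⟩ := LinearMap.injective_iff_surjective.1 hinj g
  have h0 := hzero h (by rw [hh, hg])
  refine ⟨h, h0, fun x => ?_⟩
  have := congrFun hh x
  change h x - nbrAvg G h x + degInner G h (fun _ => 1) = g x at this
  linarith

/-- A bounded function which decreases by one on average away from `v`; it bounds the expected
time at which the simple random walk hits `v`. -/
theorem HasGap.exists_hitting_potential [DecidableEq V] (hG : ∀ x, 0 < G.degree x) {D : ℕ}
    (hD : ∀ x, G.degree x ≤ D) {γ : ℝ} (hγ : HasGap G γ) (hγ0 : 0 < γ) (v : V) :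
    ∃ f : V → ℝ, (∀ x, 0 ≤ f x ∧ f x ≤ D * Fintype.card V / γ) ∧
      ∀ x, x ≠ v → nbrAvg G f x = f x - 1 := by
  have : Nonempty V := ⟨v⟩
  set m := degInner G (fun _ => (1 : ℝ)) (fun _ => 1) with hm
  have hm0 : 0 < m := degInner_one_pos hG
  have hmle : m ≤ D * Fintype.card V := degInner_one_le hD
  have hdv : (1 : ℝ) ≤ G.degree v := by exact_mod_cast hG v
  -- `a` is the mean return time to `v`, the only weight at `v` for which `g` has mean zero.
  set a : ℝ := m / G.degree v with ha
  have hda : (G.degree v : ℝ) * a = m := by rw [ha]; field_simp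
  set g : V → ℝ := fun x => 1 - if x = v then a else 0 with hg
  have hmsum : ∑ x, (G.degree x : ℝ) = m := by simp [hm, degInner]
  have hg0 : degInner G g (fun _ => 1) = 0 := by
    simp only [degInner, hg, mul_one, mul_sub, Finset.sum_sub_distrib, mul_ite, mul_zero,
      Finset.sum_ite_eq', Finset.mem_univ, if_true]
    rw [hda, hmsum]; ring
  have hgg : degInner G g g ≤ m ^ 2 := by
    have h1 : degInner G g g = ∑ x, ((G.degree x : ℝ) -
        if x = v then (G.degree x : ℝ) * (2 * a - a ^ 2) else 0) := by
      refine Finset.sum_congr rfl fun x _ => ?_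
      by_cases hx : x = v
      · simp only [hg, hx, if_true]; ring
      · simp [hg, hx]
    rw [h1, Finset.sum_sub_distrib, hmsum, Finset.sum_ite_eq', if_pos (Finset.mem_univ _)]
    have ha0 : 0 ≤ a := by positivity
    have ham : a ≤ m := by rw [ha]; exact div_le_self hm0.le hdv
    have : (G.degree v : ℝ) * (2 * a - a ^ 2) = 2 * m - m * a := by
      rw [← hda]; ring
    rw [this]; nlinarith
  obtain ⟨h, h0, hh⟩ := hγ.exists_poisson hG hγ0 hg0
  -- Energy estimate. The gap `γ` of the lazy walk is `2γ` for the simple walk, so `⟨h, g⟩ ≥ 2γ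
  -- ‖h‖²`; Young's inequality absorbs half of this. The bound on the norm is then a pointwise
  -- bound, and adding it as a constant makes the potential nonnegative.
  have hhh : degInner G h h ≤ (m / (2 * γ)) ^ 2 := by
    have e1 : degInner G h g = degInner G h h - degInner G h (nbrAvg G h) := by
      rw [← funext hh]
      simp only [degInner, ← Finset.sum_sub_distrib]
      exact Finset.sum_congr rfl fun x _ => by ring
    have e2 := hγ h h0
    rw [degInner_lazyAvg] at e2
    have e3 : degInner G h g ≤ γ * degInner G h h + degInner G g g / (4 * γ) := by
      simp only [degInner, Finset.mul_sum, Finset.sum_div, ← Finset.sum_add_distrib]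
      refine Finset.sum_le_sum fun x _ => ?_
      have : (G.degree x : ℝ) * (h x * g x) ≤
          (G.degree x : ℝ) * (γ * (h x * h x) + g x * g x / (4 * γ)) := by
        refine mul_le_mul_of_nonneg_left ?_ (Nat.cast_nonneg _)
        have : γ * (h x * h x) + g x * g x / (4 * γ) - h x * g x =
            (2 * γ * h x - g x) ^ 2 / (4 * γ) := by field_simp; ring
        have : 0 ≤ (2 * γ * h x - g x) ^ 2 / (4 * γ) := by positivity
        linarith
      refine this.trans (le_of_eq (by ring))
    have e4 : γ * degInner G h h ≤ m ^ 2 / (4 * γ) := by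
      have : degInner G g g / (4 * γ) ≤ m ^ 2 / (4 * γ) :=
        div_le_div_of_nonneg_right hgg (by positivity)
      linarith
    rw [le_div_iff₀ (by positivity)] at e4
    rw [div_pow, le_div_iff₀ (by positivity)]
    linarith
  have hbd : ∀ x, |h x| ≤ m / (2 * γ) := fun x =>
    abs_le_of_sq_le_sq ((sq_le_degInner_self hG h x).trans hhh) (by positivity)
  refine ⟨fun x => h x + m / (2 * γ), fun x => ?_, fun x hx => ?_⟩
  · have h1 := abs_le.1 (hbd x)
    refine ⟨by linarith, ?_⟩
    calc h x + m / (2 * γ) ≤ m / (2 * γ) + m / (2 * γ) := by linarith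
      _ = m / γ := by field_simp; ring
      _ ≤ _ := div_le_div_of_nonneg_right hmle hγ0.le
  · rw [nbrAvg_add_const hG]
    have := hh x
    simp only [hg, hx, if_false, sub_zero] at this
    linarith

end Mixing

/-! ### The gain from two choices, and the greedy rule. -/

section Boost

/-- The expected maximum of two independent samples from a set of at most `D` numbers dominates
a power mean of exponent larger than one. -/
theorem rpow_mean_le_mean_max_rpow {ι : Type*} [DecidableEq ι] {N : Finset ι} (hN : N.Nonempty)
    {D : ℕ} (hD : N.card ≤ D) {p : ι → ℝ} (hp : ∀ i, 0 ≤ p i) :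
    ((∑ i ∈ N, p i) / N.card) ^ (1 - 1 / (D : ℝ)) ≤
      (∑ c ∈ N ×ˢ N, max (p c.1) (p c.2) ^ (1 - 1 / (D : ℝ))) / (N.card : ℝ) ^ 2 := by
  set k : ℝ := (N.card : ℝ) with hk
  have hk1 : 1 ≤ k := by rw [hk]; exact_mod_cast hN.card_pos
  have hkD : k ≤ D := by rw [hk]; exact_mod_cast hD
  have hD1 : (1 : ℝ) ≤ D := hk1.trans hkD
  set β : ℝ := 1 - 1 / (D : ℝ) with hβ
  have hDinv : 1 / (D : ℝ) ≤ 1 := by rw [div_le_one (by linarith)]; exact hD1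
  have hDinv0 : 0 ≤ 1 / (D : ℝ) := by positivity
  have hβ0 : 0 ≤ β := by rw [hβ]; linarith
  obtain ⟨i₀, hi₀, hmax⟩ := N.exists_max_image p hN
  set m := p i₀ with hm
  have hm0 : 0 ≤ m := hp i₀
  set U : ℝ := (∑ i ∈ N, p i ^ β) / k with hU
  have hUk : ∑ i ∈ N, p i ^ β = k * U := by rw [hU]; field_simp
  have hU0 : 0 ≤ U := div_nonneg (Finset.sum_nonneg fun i _ => Real.rpow_nonneg (hp i) _)
    (by linarith)
  have hmU : U ≤ m ^ β := by
    rw [hU, div_le_iff₀ (by linarith)]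
    calc ∑ i ∈ N, p i ^ β ≤ ∑ _i ∈ N, m ^ β :=
          Finset.sum_le_sum fun i hi => Real.rpow_le_rpow (hp i) (hmax i hi) hβ0
      _ = m ^ β * k := by simp [hk, mul_comm]
  -- For each first sample, pairing it with the maximiser `i₀` gives `m ^ β`, and any other second
  -- sample gives at least the first sample's own value.
  have hA : k * m ^ β + (k - 1) * (k * U) ≤
      ∑ c ∈ N ×ˢ N, max (p c.1) (p c.2) ^ β := by
    rw [Finset.sum_product, ← hUk, Finset.mul_sum]
    have : k * m ^ β = ∑ _i ∈ N, m ^ β := by rw [Finset.sum_const, nsmul_eq_mul]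
    rw [this, ← Finset.sum_add_distrib]
    refine Finset.sum_le_sum fun i hi => ?_
    rw [← Finset.add_sum_erase N _ hi₀]
    refine add_le_add (Real.rpow_le_rpow hm0 (le_max_right _ _) hβ0) ?_
    have hc : ((N.erase i₀).card : ℝ) = k - 1 := by
      rw [Finset.card_erase_of_mem hi₀, Nat.cast_sub hN.card_pos, Nat.cast_one]
    calc (k - 1) * p i ^ β = ∑ _j ∈ N.erase i₀, p i ^ β := by
          rw [Finset.sum_const, nsmul_eq_mul, hc]
      _ ≤ _ := Finset.sum_le_sum fun j _ => Real.rpow_le_rpow (hp i) (le_max_left _ _) hβ0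
  -- Weight moves from `m ^ β` to the smaller `U`. The weights are now `1 / D` and `β`, and weighted
  -- AM-GM bounds the sum below by `m ^ (β / D) * U ^ β`. This is the `β`-th power of `m ^ (1 / D) *
  -- U`, which dominates the mean of `p` because `p = p ^ (1 / D) * p ^ β`.
  have hB : 1 / (D : ℝ) * m ^ β + β * U ≤
      (∑ c ∈ N ×ˢ N, max (p c.1) (p c.2) ^ β) / k ^ 2 := by
    have h1 : 1 / (D : ℝ) ≤ 1 / k := one_div_le_one_div_of_le (by linarith) hkD
    have h2 : 1 / k * m ^ β + (1 - 1 / k) * U = (k * m ^ β + (k - 1) * (k * U)) / k ^ 2 := by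
      field_simp
    have h3 : 1 / (D : ℝ) * m ^ β + β * U ≤ 1 / k * m ^ β + (1 - 1 / k) * U := by
      rw [hβ]; nlinarith
    rw [h2] at h3
    exact h3.trans (div_le_div_of_nonneg_right hA (sq_nonneg k))
  refine le_trans ?_ hB
  refine le_trans ?_ (Real.geom_mean_le_arith_mean2_weighted hDinv0 hβ0
    (Real.rpow_nonneg hm0 β) hU0 (by rw [hβ]; ring))
  have hmean : (∑ i ∈ N, p i) / k ≤ m ^ (1 / (D : ℝ)) * U := by
    rw [div_le_iff₀ (by linarith), mul_assoc, mul_comm U k, ← hUk, Finset.mul_sum]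
    refine Finset.sum_le_sum fun i hi => ?_
    rcases (hp i).eq_or_lt with h0 | h0
    · rw [← h0]; positivity
    calc p i = p i ^ (1 / (D : ℝ)) * p i ^ β := by
          rw [← Real.rpow_add h0, hβ, add_sub_cancel, Real.rpow_one]
      _ ≤ _ := mul_le_mul_of_nonneg_right (Real.rpow_le_rpow (hp i) (hmax i hi) hDinv0)
          (Real.rpow_nonneg (hp i) _)
  have hmean0 : 0 ≤ (∑ i ∈ N, p i) / k :=
    div_nonneg (Finset.sum_nonneg fun i _ => hp i) (by linarith)
  refine (Real.rpow_le_rpow hmean0 hmean hβ0).trans (le_of_eq ?_)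
  rw [Real.mul_rpow (Real.rpow_nonneg hm0 _) hU0, ← Real.rpow_mul hm0, ← Real.rpow_mul hm0,
    mul_comm β]

lemma indicator_mem_Icc {V : Type*} [DecidableEq V] (S : Finset V) (x : V) :
    (if x ∈ S then (1 : ℝ) else 0) ∈ Set.Icc (0 : ℝ) 1 := by
  split_ifs <;> simp

variable {V : Type*} [Fintype V] [DecidableEq V] {G : SimpleGraph V} [DecidableRel G.Adj]

variable (G) in
/-- The best discounted probability that the lazy walk is in `S` at some fixed time up to `T`,
with discount `(1 + 1 / T)⁻¹` per step. -/
noncomputable def reachFun (T : ℕ) (S : Finset V) (x : V) : ℝ :=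
  (Finset.range (T + 1)).sup' ⟨0, by simp⟩ fun k =>
    ((1 + 1 / (T : ℝ))⁻¹) ^ k * (lazyAvg G)^[k] (fun y => if y ∈ S then 1 else 0) x

lemma le_reachFun (T : ℕ) (S : Finset V) (x : V) {k : ℕ} (hk : k ≤ T) :
    ((1 + 1 / (T : ℝ))⁻¹) ^ k * (lazyAvg G)^[k] (fun y => if y ∈ S then 1 else 0) x ≤
      reachFun G T S x :=
  Finset.le_sup' (fun k => ((1 + 1 / (T : ℝ))⁻¹) ^ k *
    (lazyAvg G)^[k] (fun y => if y ∈ S then 1 else 0) x) (by simp; omega)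

lemma reachFun_nonneg (T : ℕ) (S : Finset V) (x : V) : 0 ≤ reachFun G T S x := by
  refine le_trans ?_ (le_reachFun T S x (Nat.zero_le T))
  simpa using (indicator_mem_Icc S x).1

lemma reachFun_le_one (hG : ∀ x, 0 < G.degree x) (T : ℕ) (S : Finset V) (x : V) :
    reachFun G T S x ≤ 1 := by
  refine Finset.sup'_le _ _ fun k _ => ?_
  have h := iterate_lazyAvg_mem_Icc hG (indicator_mem_Icc S) k x
  have h1 : (1 : ℝ) ≤ 1 + 1 / T := by
    have : (0 : ℝ) ≤ 1 / T := by positivity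
    linarith
  exact mul_le_one₀ (pow_le_one₀ (by positivity) (inv_le_one_of_one_le₀ h1)) h.1 h.2

lemma reachFun_eq_one (hG : ∀ x, 0 < G.degree x) (T : ℕ) {S : Finset V} {x : V} (hx : x ∈ S) :
    reachFun G T S x = 1 := by
  refine le_antisymm (reachFun_le_one hG T S x) ?_
  simpa [hx] using le_reachFun (G := G) T S x (Nat.zero_le T)

/-- An optimal time `0` gives value zero off `S`. An optimal time `j + 1` can be used as `j` after
one lazy step, which removes one discount: `(1 + 1/T) p ≤ (p + nbrAvg p) / 2`. Solving for the
non-lazy average doubles the gain. -/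
lemma mul_reachFun_le_nbrAvg (T : ℕ) {S : Finset V} {x : V} (hx : x ∉ S) :
    (1 + 2 / (T : ℝ)) * reachFun G T S x ≤ nbrAvg G (reachFun G T S) x := by
  have hr : (0 : ℝ) < 1 + 1 / T := by positivity
  obtain ⟨k, hk, h⟩ := Finset.exists_mem_eq_sup' (s := Finset.range (T + 1)) ⟨0, by simp⟩
    (fun k => ((1 + 1 / (T : ℝ))⁻¹) ^ k *
      (lazyAvg G)^[k] (fun y => if y ∈ S then 1 else 0) x)
  change reachFun G T S x = _ at h
  cases k with
  | zero =>
    have h0 : reachFun G T S x = 0 := by simpa [hx] using h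
    rw [h0, mul_zero]
    exact div_nonneg (Finset.sum_nonneg fun y _ => reachFun_nonneg T S y) (Nat.cast_nonneg _)
  | succ j =>
    have hj : j ≤ T := by simp at hk; omega
    set a := (lazyAvg G)^[j] (fun y => if y ∈ S then (1 : ℝ) else 0) with ha
    have h1 := le_reachFun (G := G) T S x hj
    have h2 := nbrAvg_mono (G := G) (fun y => le_reachFun (G := G) T S y hj) x
    rw [nbrAvg_const_mul] at h2
    rw [Function.iterate_succ_apply', ← ha, lazyAvg, pow_succ] at h
    rw [← ha] at h1 h2
    have h3 : (1 + 1 / (T : ℝ)) * reachFun G T S x =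
        (((1 + 1 / (T : ℝ))⁻¹) ^ j * a x + ((1 + 1 / (T : ℝ))⁻¹) ^ j * nbrAvg G a x) / 2 := by
      rw [h]; field_simp
    have h4 : (1 + 2 / (T : ℝ)) * reachFun G T S x =
        2 * ((1 + 1 / (T : ℝ)) * reachFun G T S x) - reachFun G T S x := by ring
    rw [h4, h3]
    linarith

lemma one_add_inv_pow_le_three {T : ℕ} (hT : 0 < T) : (1 + 1 / (T : ℝ)) ^ T ≤ 3 := by
  have hT' : (T : ℝ) ≠ 0 := by positivity
  calc (1 + 1 / (T : ℝ)) ^ T ≤ Real.exp (1 / T) ^ T :=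
        pow_le_pow_left₀ (by positivity) (by linarith [Real.add_one_le_exp (1 / (T : ℝ))]) _
    _ = Real.exp 1 := by rw [← Real.exp_nat_mul]; congr 1; field_simp
    _ ≤ 3 := Real.exp_one_lt_three.le

/-- Time `T` is used: the walk has mixed, and the total discount `(1 + 1/T) ^ (-T)` costs at most a
factor `3`. -/
lemma HasGap.le_reachFun (hG : ∀ x, 0 < G.degree x) {D : ℕ}
    (hD : ∀ x, G.degree x ≤ D) {γ : ℝ} (hγ : HasGap G γ) (hγ1 : γ ≤ 1) {T : ℕ} (hT0 : 0 < T)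
    (hT : (1 - γ) ^ T * (4 * D ^ 3 * (Fintype.card V : ℝ) ^ 2) ≤ 1) (S : Finset V) (x : V) :
    (S.card : ℝ) / (6 * D * Fintype.card V) ≤ reachFun G T S x := by
  refine le_trans ?_ (ChoiceWalk.le_reachFun T S x le_rfl)
  have h := hγ.le_iterate_lazyAvg_indicator hG hD hγ1 hT S x
  have h3 : (1 : ℝ) / 3 ≤ ((1 + 1 / (T : ℝ))⁻¹) ^ T := by
    rw [inv_pow, ← one_div]
    exact one_div_le_one_div_of_le (by positivity) (one_add_inv_pow_le_three hT0)
  calc (S.card : ℝ) / (6 * D * Fintype.card V)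
      = 1 / 3 * ((S.card : ℝ) / (2 * D * Fintype.card V)) := by ring
    _ ≤ _ := mul_le_mul h3 h (by positivity) (by positivity)

variable (G) in
/-- The greedy rule: move to the offer from which `S` is more easily reached. -/
noncomputable def greedyRule (T : ℕ) : Rule V := fun _ S c d =>
  @decide (reachFun G T S d ≤ reachFun G T S c) (Classical.propDecidable _)

lemma reachFun_pick_greedyRule (T t : ℕ) (S : Finset V) (c : V × V) :
    reachFun G T S ((greedyRule G T).pick t S c) =
      max (reachFun G T S c.1) (reachFun G T S c.2) := by
  unfold Rule.pick greedyRule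
  by_cases h : reachFun G T S c.2 ≤ reachFun G T S c.1
  · simp [h]
  · simp [h, le_of_lt (not_le.1 h)]

lemma one_add_le_rpow {T : ℕ} (hT : 0 < T) {β : ℝ} (hβ : 1 / 2 ≤ β) :
    1 + 1 / (2 * (T : ℝ)) ≤ (1 + 2 / (T : ℝ)) ^ β := by
  have hT1 : (1 : ℝ) ≤ T := by exact_mod_cast hT
  have h1 : (1 : ℝ) ≤ 1 + 2 / T := by
    have : (0 : ℝ) ≤ 2 / T := by positivity
    linarith
  refine le_trans ?_ (Real.rpow_le_rpow_of_exponent_le h1 hβ)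
  rw [← Real.sqrt_eq_rpow]
  refine Real.le_sqrt_of_sq_le ?_
  have h2 : 2 / (T : ℝ) = 2 * (1 / T) := by ring
  have h3 : 1 / (2 * (T : ℝ)) = 1 / 2 * (1 / T) := by field_simp
  have h4 : 1 / (T : ℝ) ≤ 1 := by rw [div_le_one (by linarith)]; exact hT1
  have h5 : 0 ≤ 1 / (T : ℝ) := by positivity
  rw [h2, h3]; nlinarith

/-- The time allowed for hitting a set of `j` vertices among `n`. -/
noncomputable def hitCost (D n T j : ℕ) : ℝ :=
  2 * T * (6 * D * n / j) ^ (1 - 1 / (D : ℝ))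

/-- The time allowed for successively hitting `s` vertices. -/
noncomputable def coverCost (D n T s : ℕ) : ℝ := ∑ j ∈ Finset.range s, hitCost D n T (j + 1)

lemma hitCost_nonneg (D n T j : ℕ) : 0 ≤ hitCost D n T j := by
  unfold hitCost; positivity

lemma coverCost_succ (D n T s : ℕ) :
    coverCost D n T (s + 1) = coverCost D n T s + hitCost D n T (s + 1) :=
  Finset.sum_range_succ _ _

lemma coverCost_nonneg (D n T s : ℕ) : 0 ≤ coverCost D n T s :=
  Finset.sum_nonneg fun _ _ => hitCost_nonneg _ _ _ _

variable (G) in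
/-- The potential of the greedy rule. -/
noncomputable def greedyPotential (D T : ℕ) (S : Finset V) (x : V) : ℝ :=
  coverCost D (Fintype.card V) T S.card -
    (if S.card = 0 then 0 else
      reachFun G T S x ^ (1 - 1 / (D : ℝ)) * hitCost D (Fintype.card V) T S.card)

lemma greedyPotential_le (D T : ℕ) (S : Finset V) (x : V) :
    greedyPotential G D T S x ≤ coverCost D (Fintype.card V) T S.card := by
  have h := Real.rpow_nonneg (reachFun_nonneg (G := G) T S x) (1 - 1 / (D : ℝ))
  have h2 := mul_nonneg h (hitCost_nonneg D (Fintype.card V) T S.card)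
  unfold greedyPotential
  split_ifs <;> linarith

lemma greedyPotential_nonneg (hG : ∀ x, 0 < G.degree x) {D : ℕ} (hD : 1 ≤ D) (T : ℕ)
    (S : Finset V) (x : V) : 0 ≤ greedyPotential G D T S x := by
  unfold greedyPotential
  split_ifs with h
  · simpa using coverCost_nonneg _ _ _ _
  · obtain ⟨s, hs⟩ := Nat.exists_eq_succ_of_ne_zero h
    rw [hs, Nat.succ_eq_add_one, coverCost_succ]
    have hβ : (0 : ℝ) ≤ 1 - 1 / (D : ℝ) := by
      have : 1 / (D : ℝ) ≤ 1 := by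
        rw [div_le_one (by exact_mod_cast hD)]; exact_mod_cast hD
      linarith
    have h1 := Real.rpow_le_one (reachFun_nonneg (G := G) T S x) (reachFun_le_one hG T S x) hβ
    nlinarith [coverCost_nonneg D (Fintype.card V) T s,
      hitCost_nonneg D (Fintype.card V) T (s + 1)]

/-- On arrival in `S` one has `reachFun = 1`, and the right side becomes the full budget for the
remaining targets. A hit and a miss thus obey the same formula, so the drift computation needs no
case distinction. -/
lemma greedyPotential_erase_le (hG : ∀ x, 0 < G.degree x) (D T : ℕ)
    {S : Finset V} (hS : S.Nonempty) (x : V) :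
    greedyPotential G D T (S.erase x) x ≤ coverCost D (Fintype.card V) T S.card -
      reachFun G T S x ^ (1 - 1 / (D : ℝ)) * hitCost D (Fintype.card V) T S.card := by
  have h0 : S.card ≠ 0 := hS.card_pos.ne'
  by_cases hx : x ∈ S
  · refine (greedyPotential_le D T _ x).trans ?_
    rw [reachFun_eq_one hG T hx, Real.one_rpow, Finset.card_erase_of_mem hx]
    obtain ⟨s, hs⟩ := Nat.exists_eq_succ_of_ne_zero h0
    rw [hs, Nat.succ_eq_add_one, coverCost_succ, Nat.add_sub_cancel]
    linarith
  · rw [Finset.erase_eq_of_notMem hx, greedyPotential, if_neg h0]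

/-- The potential of the greedy rule decreases by one in expectation at each step. -/
theorem greedyPotential_step (hG : ∀ x, 0 < G.degree x) {D : ℕ} (hD2 : 2 ≤ D)
    (hD : ∀ x, G.degree x ≤ D) {γ : ℝ} (hγ : HasGap G γ) (hγ1 : γ ≤ 1) {T : ℕ} (hT0 : 0 < T)
    (hT : (1 - γ) ^ T * (4 * D ^ 3 * (Fintype.card V : ℝ) ^ 2) ≤ 1) (t : ℕ) {S : Finset V} {x : V}
    (hS : S.Nonempty) (hx : x ∉ S) :
    1 + (∑ c ∈ offers G x, greedyPotential G D T (S.erase ((greedyRule G T).pick t S c))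
      ((greedyRule G T).pick t S c)) / (G.degree x : ℝ) ^ 2 ≤ greedyPotential G D T S x := by
  set β : ℝ := 1 - 1 / (D : ℝ) with hβ
  have hD2' : (2 : ℝ) ≤ D := by exact_mod_cast hD2
  have hβ2 : 1 / 2 ≤ β := by
    have : 1 / (D : ℝ) ≤ 1 / 2 := one_div_le_one_div_of_le (by norm_num) hD2'
    rw [hβ]; linarith
  set n := Fintype.card V with hn
  have hn0 : (0 : ℝ) < n := by
    rw [hn]; exact_mod_cast Fintype.card_pos_iff.2 ⟨x⟩
  have hs0 : (0 : ℝ) < S.card := by exact_mod_cast hS.card_pos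
  set K := hitCost D n T S.card with hK
  set F := coverCost D n T S.card with hF
  set p := reachFun G T S with hp
  have hp0 : ∀ y, 0 ≤ p y := reachFun_nonneg T S
  have hd : (0 : ℝ) < (G.degree x : ℝ) ^ 2 := by have := hG x; positivity
  have hT0' : (0 : ℝ) < T := by exact_mod_cast hT0
  have hcard : ((offers G x).card : ℝ) = (G.degree x : ℝ) ^ 2 := by
    rw [card_offers]; push_cast; rfl
  have hsum : ∑ c ∈ offers G x, greedyPotential G D T (S.erase ((greedyRule G T).pick t S c))
      ((greedyRule G T).pick t S c) ≤
      (G.degree x : ℝ) ^ 2 * F - (∑ c ∈ offers G x, max (p c.1) (p c.2) ^ β) * K := by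
    rw [← hcard, ← nsmul_eq_mul, ← Finset.sum_const, Finset.sum_mul, ← Finset.sum_sub_distrib]
    refine Finset.sum_le_sum fun c _ => ?_
    have := greedyPotential_erase_le hG D T hS ((greedyRule G T).pick t S c)
    rwa [reachFun_pick_greedyRule] at this
  have hboost : (1 + 1 / (2 * (T : ℝ))) * p x ^ β ≤
      (∑ c ∈ offers G x, max (p c.1) (p c.2) ^ β) / (G.degree x : ℝ) ^ 2 := by
    have hN : (G.neighborFinset x).Nonempty := by
      rw [← Finset.card_pos, SimpleGraph.card_neighborFinset_eq_degree]; exact hG x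
    have h := rpow_mean_le_mean_max_rpow hN (D := D)
      (by rw [SimpleGraph.card_neighborFinset_eq_degree]; exact hD x) hp0
    rw [SimpleGraph.card_neighborFinset_eq_degree] at h
    refine le_trans ?_ h
    have h1 := mul_reachFun_le_nbrAvg (G := G) T hx
    refine le_trans ?_ (Real.rpow_le_rpow (mul_nonneg (by positivity) (hp0 x)) h1 (by linarith))
    rw [Real.mul_rpow (by positivity) (hp0 x)]
    exact mul_le_mul_of_nonneg_right (one_add_le_rpow hT0 hβ2) (Real.rpow_nonneg (hp0 x) _)
  -- `hitCost` is calibrated so that even the smallest possible `p` makes the relative gain `1/(2T)`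
  -- worth at least one unit.
  have hKp : 2 * T ≤ p x ^ β * K := by
    have h1 := hγ.le_reachFun hG hD hγ1 hT0 hT S x
    have h2 : 1 ≤ p x * (6 * D * n / S.card) := by
      rw [div_le_iff₀ (by positivity)] at h1
      rw [← mul_div_assoc, le_div_iff₀ hs0, one_mul]
      exact h1
    have h3 : p x ^ β * K = 2 * T * (p x * (6 * D * n / S.card)) ^ β := by
      rw [Real.mul_rpow (hp0 x) (by positivity), hK, hitCost]; ring
    rw [h3]
    have h4 := Real.one_le_rpow h2 (by linarith : (0 : ℝ) ≤ β)
    nlinarith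
  have hK0 : 0 ≤ K := hitCost_nonneg _ _ _ _
  have hmain : (∑ c ∈ offers G x, greedyPotential G D T (S.erase ((greedyRule G T).pick t S c))
      ((greedyRule G T).pick t S c)) / (G.degree x : ℝ) ^ 2 ≤
      F - (1 + 1 / (2 * (T : ℝ))) * p x ^ β * K := by
    refine (div_le_div_of_nonneg_right hsum hd.le).trans ?_
    rw [sub_div, mul_div_cancel_left₀ _ hd.ne', mul_div_right_comm]
    linarith [mul_le_mul_of_nonneg_right hboost hK0]
  have hdef : greedyPotential G D T S x = F - p x ^ β * K := by
    rw [greedyPotential, if_neg hS.card_pos.ne']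
  have hfin : (1 : ℝ) ≤ 1 / (2 * (T : ℝ)) * (p x ^ β * K) := by
    rw [one_div, inv_mul_eq_div, le_div_iff₀ (by positivity)]
    linarith
  rw [hdef]
  linarith

/-- The hitting time of a graph with bounded degrees and a spectral gap. -/
theorem HasGap.hittingTime_le (hG : ∀ x, 0 < G.degree x) {D : ℕ} (hD2 : 2 ≤ D)
    (hD : ∀ x, G.degree x ≤ D) {γ : ℝ} (hγ : HasGap G γ) (hγ1 : γ ≤ 1) {T : ℕ} (hT0 : 0 < T)
    (hT : (1 - γ) ^ T * (4 * D ^ 3 * (Fintype.card V : ℝ) ^ 2) ≤ 1) :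
    hittingTime G ≤
      ENNReal.ofReal (2 * T * (6 * D * Fintype.card V) ^ (1 - 1 / (D : ℝ))) := by
  refine iSup₂_le fun x y => ?_
  obtain ⟨α, hα⟩ := exists_strategy_lintegral_coverOf_le hG (greedyRule G T)
    (W := fun _ => greedyPotential G D T)
    (fun _ S z => greedyPotential_nonneg hG (by omega) T S z)
    (fun t S z hS hz => greedyPotential_step hG hD2 hD hγ hγ1 hT0 hT t hS hz) {y} x
  refine (iInf_le _ α).trans ((lintegral_mono (hitAt_le_coverOf_singleton y)).trans
    (hα.trans (ENNReal.ofReal_le_ofReal ((greedyPotential_le D T _ x).trans ?_))))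
  have h1 : coverCost D (Fintype.card V) T 1 =
      2 * T * (6 * D * Fintype.card V) ^ (1 - 1 / (D : ℝ)) := by
    simp [coverCost, hitCost]
  rw [← h1]
  refine Finset.sum_le_sum_of_subset_of_nonneg (Finset.range_mono ?_)
    fun _ _ _ => hitCost_nonneg _ _ _ _
  exact (Finset.card_erase_le).trans (by simp)

end Boost

/-! ### Cover time: a simple random walk phase, then the greedy phase. -/

section Cover

variable {V : Type*} [Fintype V] {G : SimpleGraph V} [DecidableRel G.Adj]

lemma sum_offers_fst (hG : ∀ x, 0 < G.degree x) (f : V → ℝ) (x : V) :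
    (∑ c ∈ offers G x, f c.1) / (G.degree x : ℝ) ^ 2 = nbrAvg G f x := by
  have hd : (G.degree x : ℝ) ≠ 0 := by exact_mod_cast (hG x).ne'
  rw [offers, Finset.sum_product]
  simp only [Finset.sum_const, nsmul_eq_mul, SimpleGraph.card_neighborFinset_eq_degree,
    ← Finset.mul_sum]
  rw [nbrAvg]
  field_simp

variable [DecidableEq V]

/-- A potential for the simple random walk with `r` steps left, after which each unvisited vertex
costs `B`. -/
noncomputable def uniformPotential (f : V → V → ℝ) (M A B : ℝ) (r : ℕ) (S : Finset V) (x : V) :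
    ℝ :=
  r + A + B * ∑ v ∈ S, (1 + f v x / M) * (1 - 1 / (2 * M)) ^ r

/-- The summand `(1 + f v x / M) ρ ^ r` dominates the probability of missing `v` for `r` more steps:
away from `v`, the factor in brackets has drift `-1/M` and size at most `2`, so it shrinks by `ρ = 1
- 1/(2M)` on average. -/
lemma uniformPotential_step (hG : ∀ x, 0 < G.degree x) {f : V → V → ℝ} {M A B : ℝ}
    (hM : 1 ≤ M) (hB : 0 ≤ B) (hf : ∀ v x, 0 ≤ f v x ∧ f v x ≤ M)
    (hstep : ∀ v x, x ≠ v → nbrAvg G (f v) x = f v x - 1) (r : ℕ) {S : Finset V} {x : V}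
    (hx : x ∉ S) :
    1 + nbrAvg G (fun c => uniformPotential f M A B r (S.erase c) c) x ≤
      uniformPotential f M A B (r + 1) S x := by
  have hd : (G.degree x : ℝ) ≠ 0 := by exact_mod_cast (hG x).ne'
  have hM0 : 0 < M := by linarith
  set ρ : ℝ := 1 - 1 / (2 * M) with hρ
  have hρ0 : 0 ≤ ρ := by
    have : 1 / (2 * M) ≤ 1 := by rw [div_le_one (by linarith)]; linarith
    rw [hρ]; linarith
  have hterm : ∀ v c, 0 ≤ (1 + f v c / M) * ρ ^ r := fun v c =>
    mul_nonneg (add_nonneg zero_le_one (div_nonneg (hf v c).1 hM0.le)) (pow_nonneg hρ0 r)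
  have h1 : nbrAvg G (fun c => uniformPotential f M A B r (S.erase c) c) x ≤
      nbrAvg G (fun c => r + A + B * ∑ v ∈ S, (1 + f v c / M) * ρ ^ r) x := by
    refine nbrAvg_mono (fun c => ?_) x
    refine add_le_add le_rfl (mul_le_mul_of_nonneg_left ?_ hB)
    exact Finset.sum_le_sum_of_subset_of_nonneg (Finset.erase_subset _ _)
      fun v _ _ => hterm v c
  have h2 : nbrAvg G (fun c => r + A + B * ∑ v ∈ S, (1 + f v c / M) * ρ ^ r) x =
      r + A + B * ∑ v ∈ S, (1 + nbrAvg G (f v) x / M) * ρ ^ r := by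
    simp only [nbrAvg]
    rw [Finset.sum_add_distrib, ← Finset.mul_sum, Finset.sum_comm, sum_neighborFinset_const,
      add_div, mul_div_cancel_left₀ _ hd, mul_div_assoc, Finset.sum_div]
    congr 2
    refine Finset.sum_congr rfl fun v _ => ?_
    rw [← Finset.sum_mul, Finset.sum_add_distrib, sum_neighborFinset_const, ← Finset.sum_div]
    field_simp
  have h3 : ∑ v ∈ S, (1 + nbrAvg G (f v) x / M) * ρ ^ r ≤
      ∑ v ∈ S, (1 + f v x / M) * ρ ^ (r + 1) := by
    refine Finset.sum_le_sum fun v hv => ?_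
    rw [hstep v x (fun h => hx (h ▸ hv)), pow_succ', ← mul_assoc]
    refine mul_le_mul_of_nonneg_right ?_ (pow_nonneg hρ0 r)
    have h4 : f v x / M ≤ 1 := by rw [div_le_one hM0]; exact (hf v x).2
    have h5 : (1 + f v x / M) * ρ - (1 + (f v x - 1) / M) = (1 - f v x / M) / (2 * M) := by
      rw [hρ]; field_simp; ring
    have h6 : 0 ≤ (1 - f v x / M) / (2 * M) := div_nonneg (by linarith) (by linarith)
    linarith
  have h7 := mul_le_mul_of_nonneg_left h3 hB
  simp only [uniformPotential, ← hρ] at *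
  push_cast
  linarith

/-- The cover time of a graph with bounded degrees and a spectral gap: after `t₁` steps of the
simple random walk the remaining vertices are collected by the greedy rule. -/
theorem HasGap.coverTime_le (hG : ∀ x, 0 < G.degree x) {D : ℕ} (hD2 : 2 ≤ D)
    (hD : ∀ x, G.degree x ≤ D) {γ : ℝ} (hγ : HasGap G γ) (hγ0 : 0 < γ) (hγ1 : γ ≤ 1) {T : ℕ}
    (hT0 : 0 < T) (hT : (1 - γ) ^ T * (4 * D ^ 3 * (Fintype.card V : ℝ) ^ 2) ≤ 1)
    {A B : ℝ} (hA : 0 ≤ A) (hB : 0 ≤ B)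
    (hAB : ∀ s ≤ Fintype.card V, coverCost D (Fintype.card V) T s ≤ A + B * s) (t₁ : ℕ) :
    coverTime G ≤ ENNReal.ofReal (t₁ + A + 2 * B * Fintype.card V *
      Real.exp (-t₁ / (2 * (D * Fintype.card V / γ)))) := by
  refine iSup_le fun x => ?_
  set n : ℝ := (Fintype.card V : ℝ) with hn
  have hn1 : 1 ≤ n := by rw [hn]; exact_mod_cast Fintype.card_pos_iff.2 ⟨x⟩
  have hD2' : (2 : ℝ) ≤ D := by exact_mod_cast hD2
  set M : ℝ := D * n / γ with hM
  have hM1 : 1 ≤ M := by rw [hM, le_div_iff₀ hγ0]; nlinarith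
  choose f hf hfstep using fun v => hγ.exists_hitting_potential hG hD hγ0 v
  have hρ0 : 0 ≤ 1 - 1 / (2 * M) := by
    have : 1 / (2 * M) ≤ 1 := by rw [div_le_one (by linarith)]; linarith
    linarith
  -- Always taking the first offer is the simple random walk.
  let b : Rule V := fun t S c d => if t < t₁ then true else greedyRule G T t S c d
  let W : ℕ → Finset V → V → ℝ := fun t S z =>
    if t < t₁ then uniformPotential f M A B (t₁ - t) S z else greedyPotential G D T S z
  have hunif0 : ∀ r S z, 0 ≤ uniformPotential f M A B r S z := fun r S z =>
    add_nonneg (add_nonneg (Nat.cast_nonneg _) hA) (mul_nonneg hB (Finset.sum_nonneg fun v _ =>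
      mul_nonneg (add_nonneg zero_le_one (div_nonneg (hf v z).1 (by linarith)))
        (pow_nonneg hρ0 r)))
  have hW0 : ∀ t S z, 0 ≤ W t S z := by
    intro t S z
    by_cases h : t < t₁
    · simp only [W, if_pos h]; exact hunif0 _ _ _
    · simp only [W, if_neg h]; exact greedyPotential_nonneg hG (by omega) T S z
  -- The two phases are glued at `t = t₁`, where the affine bound `hAB` puts the greedy potential
  -- below the first-phase potential with no steps left.
  have hWle : ∀ t ≤ t₁, ∀ S z, W t S z ≤ uniformPotential f M A B (t₁ - t) S z := by
    intro t ht S z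
    rcases ht.lt_or_eq with h | rfl
    · simp only [W, if_pos h]; exact le_rfl
    · simp only [W, lt_irrefl, if_false, Nat.sub_self]
      refine (greedyPotential_le D T S z).trans ((hAB _ (Finset.card_le_univ S)).trans ?_)
      simp only [uniformPotential, Nat.cast_zero, zero_add, pow_zero, mul_one]
      refine add_le_add le_rfl (mul_le_mul_of_nonneg_left ?_ hB)
      rw [← nsmul_one, ← Finset.sum_const]
      exact Finset.sum_le_sum fun v _ =>
        le_add_of_nonneg_right (div_nonneg (hf v z).1 (by linarith))
  obtain ⟨α, hα⟩ := exists_strategy_lintegral_coverOf_le hG b (W := W) hW0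
    (fun t S z hS hz => by
      by_cases h : t < t₁
      · have hpick : ∀ c, b.pick t S c = c.1 := fun c => by simp [Rule.pick, b, h]
        simp only [hpick]
        rw [sum_offers_fst hG (fun y => W (t + 1) (S.erase y) y)]
        have h1 := uniformPotential_step (A := A) hG hM1 hB hf hfstep (t₁ - (t + 1)) hz
        have h2 := nbrAvg_mono (G := G) (fun y => hWle (t + 1) h (S.erase y) y) z
        rw [show t₁ - (t + 1) + 1 = t₁ - t by omega] at h1
        simp only [W, if_pos h] at *
        linarith
      · have h' : ¬ t + 1 < t₁ := by omega
        have hpick : ∀ c, b.pick t S c = (greedyRule G T).pick t S c := fun c => by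
          simp [Rule.pick, b, h]
        simp only [hpick, W, if_neg h, if_neg h']
        exact greedyPotential_step hG hD2 hD hγ hγ1 hT0 hT t hS hz) Finset.univ x
  refine (iInf_le _ α).trans ?_
  simp only [coverAt_eq_coverOf_univ]
  refine hα.trans (ENNReal.ofReal_le_ofReal ((hWle 0 (Nat.zero_le _) _ _).trans ?_))
  rw [Nat.sub_zero, uniformPotential]
  refine add_le_add le_rfl ?_
  have hexp : (1 - 1 / (2 * M)) ^ t₁ ≤ Real.exp (-t₁ / (2 * M)) := by
    calc (1 - 1 / (2 * M)) ^ t₁ ≤ Real.exp (-(1 / (2 * M))) ^ t₁ :=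
          pow_le_pow_left₀ hρ0 (Real.one_sub_le_exp_neg _) _
      _ = _ := by rw [← Real.exp_nat_mul]; congr 1; ring
  have hsum : ∑ v ∈ Finset.univ.erase x, (1 + f v x / M) * (1 - 1 / (2 * M)) ^ t₁ ≤
      n * (2 * Real.exp (-t₁ / (2 * M))) := by
    calc ∑ v ∈ Finset.univ.erase x, (1 + f v x / M) * (1 - 1 / (2 * M)) ^ t₁
        ≤ ∑ _v ∈ Finset.univ.erase x, 2 * Real.exp (-t₁ / (2 * M)) := by
          refine Finset.sum_le_sum fun v _ => mul_le_mul ?_ hexp (pow_nonneg hρ0 _) (by norm_num)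
          have : f v x / M ≤ 1 := by rw [div_le_one (by linarith)]; exact (hf v x).2
          linarith
      _ ≤ _ := by
          rw [Finset.sum_const, nsmul_eq_mul]
          refine mul_le_mul_of_nonneg_right ?_ (by positivity)
          rw [hn]; exact_mod_cast Finset.card_le_univ _
  calc _ ≤ B * (n * (2 * Real.exp (-t₁ / (2 * M)))) := mul_le_mul_of_nonneg_left hsum hB
    _ = _ := by ring

/-- The first term covers `x ≤ B`, the second `x ≥ B`, where `x ^ (β - 1) ≤ B ^ (β - 1)`. -/
lemma rpow_le_add_mul {β x B : ℝ} (hβ0 : 0 ≤ β) (hβ : β ≤ 1) (hx : 0 ≤ x) (hB : 1 ≤ B) :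
    x ^ β ≤ B + x * B ^ (-(1 - β)) := by
  have hB0 : 0 < B := by linarith
  rcases le_total x B with h | h
  · have h1 : x ^ β ≤ B := by
      calc x ^ β ≤ B ^ β := Real.rpow_le_rpow hx h hβ0
        _ ≤ B ^ (1 : ℝ) := Real.rpow_le_rpow_of_exponent_le hB hβ
        _ = B := Real.rpow_one B
    have : 0 ≤ x * B ^ (-(1 - β)) := by positivity
    linarith
  · have hx0 : 0 < x := hB0.trans_le h
    have h1 : x ^ β = x * x ^ (-(1 - β)) := by
      have := Real.rpow_add hx0 1 (-(1 - β))
      rwa [Real.rpow_one, show (1 : ℝ) + -(1 - β) = β by ring] at this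
    have h2 : x ^ (-(1 - β)) ≤ B ^ (-(1 - β)) :=
      Real.rpow_le_rpow_of_nonpos hB0 h (by linarith)
    rw [h1]
    linarith [mul_le_mul_of_nonneg_left h2 hx]

/-- An affine bound in `s` can be averaged over the random number of missed vertices. Splitting each
summand at the threshold `B` leaves a term linear in `s` and a harmonic sum. -/
lemma coverCost_le {D n T s : ℕ} (hD : 1 ≤ D) (hs : s ≤ n) {B : ℝ} (hB : 1 ≤ B) :
    coverCost D n T s ≤ 2 * T * (6 * D * n * (1 + Real.log n)) * B ^ (-(1 / (D : ℝ))) +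
      2 * T * B * s := by
  have hD' : (1 : ℝ) ≤ D := by exact_mod_cast hD
  have hinv : 1 / (D : ℝ) ≤ 1 := by rw [div_le_one (by linarith)]; exact hD'
  have hinv0 : 0 ≤ 1 / (D : ℝ) := by positivity
  set E := B ^ (-(1 / (D : ℝ))) with hE
  have hE0 : 0 ≤ E := by rw [hE]; positivity
  have h1 : ∀ j : ℕ, hitCost D n T (j + 1) ≤
      2 * T * B + 2 * T * (6 * D * n) * E * ((j + 1 : ℕ) : ℝ)⁻¹ := by
    intro j
    have := rpow_le_add_mul (β := 1 - 1 / (D : ℝ)) (x := 6 * D * n / (j + 1 : ℕ)) (B := B)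
      (by linarith) (by linarith) (by positivity) hB
    rw [sub_sub_cancel, ← hE] at this
    calc hitCost D n T (j + 1) ≤ 2 * T * (B + 6 * D * n / (j + 1 : ℕ) * E) :=
          mul_le_mul_of_nonneg_left this (by positivity)
      _ = _ := by ring
  have h2 : ∑ j ∈ Finset.range s, ((j + 1 : ℕ) : ℝ)⁻¹ ≤ 1 + Real.log n := by
    have h3 := harmonic_le_one_add_log n
    rw [harmonic] at h3
    push_cast at h3 ⊢
    refine le_trans ?_ h3
    exact Finset.sum_le_sum_of_subset_of_nonneg (Finset.range_mono hs)
      fun _ _ _ => by positivity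
  calc coverCost D n T s ≤
        ∑ j ∈ Finset.range s, (2 * T * B + 2 * T * (6 * D * n) * E * ((j + 1 : ℕ) : ℝ)⁻¹) :=
        Finset.sum_le_sum fun j _ => h1 j
    _ = 2 * T * B * s + 2 * T * (6 * D * n) * E * ∑ j ∈ Finset.range s, ((j + 1 : ℕ) : ℝ)⁻¹ := by
        rw [Finset.sum_add_distrib, Finset.sum_const, Finset.card_range, nsmul_eq_mul,
          mul_comm (s : ℝ), Finset.mul_sum]
    _ ≤ 2 * T * B * s + 2 * T * (6 * D * n) * E * (1 + Real.log n) :=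
        add_le_add le_rfl (mul_le_mul_of_nonneg_left h2 (by positivity))
    _ = _ := by ring

end Cover

/-! ### Choice of parameters as `n → ∞`. -/

section Asymptotic

lemma pow_mul_le_one_of_log_le {γ X : ℝ} (hγ1 : γ ≤ 1) (hX : 0 < X) {T : ℕ}
    (hT : Real.log X ≤ γ * T) : (1 - γ) ^ T * X ≤ 1 := by
  have h1 : (1 - γ) ^ T ≤ Real.exp (-(γ * T)) := by
    calc (1 - γ) ^ T ≤ Real.exp (-γ) ^ T :=
          pow_le_pow_left₀ (by linarith) (Real.one_sub_le_exp_neg γ) _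
      _ = _ := by rw [← Real.exp_nat_mul]; congr 1; ring
  have h2 : Real.exp (-(γ * T)) ≤ X⁻¹ := by
    rw [Real.exp_neg]
    exact inv_anti₀ hX ((Real.log_le_iff_le_exp hX).1 hT)
  calc (1 - γ) ^ T * X ≤ X⁻¹ * X := mul_le_mul_of_nonneg_right (h1.trans h2) hX.le
    _ = 1 := inv_mul_cancel₀ hX.ne'

/-- A mixing time of order `log n`. -/
lemma exists_mixing_time {γ : ℝ} (hγ0 : 0 < γ) (hγ1 : γ ≤ 1) {D : ℕ} (hD : 1 ≤ D) :
    ∀ᶠ n : ℕ in atTop, ∃ T : ℕ, 0 < T ∧ (T : ℝ) ≤ 4 / γ * Real.log n ∧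
      (1 - γ) ^ T * (4 * D ^ 3 * (n : ℝ) ^ 2) ≤ 1 := by
  have hlog : Tendsto (fun n : ℕ => Real.log n) atTop atTop :=
    Real.tendsto_log_atTop.comp tendsto_natCast_atTop_atTop
  filter_upwards [hlog.eventually_ge_atTop 1, hlog.eventually_ge_atTop (Real.log (4 * D ^ 3)),
    eventually_ge_atTop 1] with n h1 h2 hn
  have hn0 : (0 : ℝ) < n := by exact_mod_cast hn
  have hD0 : (0 : ℝ) < D := by exact_mod_cast hD
  set X : ℝ := 4 * D ^ 3 * (n : ℝ) ^ 2 with hX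
  have hX0 : 0 < X := by positivity
  have hlogX : Real.log X = Real.log (4 * D ^ 3) + 2 * Real.log n := by
    rw [hX, Real.log_mul (by positivity) (by positivity), Real.log_pow]; norm_num
  have hD3 : 0 ≤ Real.log (4 * (D : ℝ) ^ 3) := by
    refine Real.log_nonneg ?_
    have : (1 : ℝ) ≤ (D : ℝ) ^ 3 := one_le_pow₀ (by exact_mod_cast hD)
    linarith
  have hpos : 0 < Real.log X / γ := div_pos (by linarith) hγ0
  -- Eventually `log X ≤ 3 log n`; the fourth `log n` absorbs the rounding, as `γ ≤ 1 ≤ log n`.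
  refine ⟨⌈Real.log X / γ⌉₊, Nat.ceil_pos.2 hpos, ?_, pow_mul_le_one_of_log_le hγ1 hX0 ?_⟩
  · refine (Nat.ceil_lt_add_one hpos.le).le.trans ?_
    rw [div_add_one hγ0.ne', div_mul_eq_mul_div]
    exact div_le_div_of_nonneg_right (by linarith) hγ0.le
  · have := Nat.le_ceil (Real.log X / γ)
    rw [div_le_iff₀ hγ0] at this
    linarith

variable {V : ℕ → Type*} [∀ n, Fintype (V n)] [∀ n, DecidableEq (V n)]
    {G : (n : ℕ) → SimpleGraph (V n)} [∀ n, DecidableRel (G n).Adj]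

lemma eventually_hasGap (hcard : ∀ n, Fintype.card (V n) = n)
    (hG : ∀ n, 2 ≤ n → ∀ x, 0 < (G n).degree x)
    (hexp : (fun n => relaxationTime (G n)) =Θ[atTop] fun _ => (1 : ℝ)) :
    ∃ γ : ℝ, 0 < γ ∧ γ ≤ 1 ∧ ∀ᶠ n in atTop, HasGap (G n) γ := by
  obtain ⟨C, hC0, hC⟩ := hexp.1.exists_pos
  obtain ⟨c, hc0, hc⟩ := hexp.2.exists_pos
  refine ⟨min (1 / C) 1, lt_min (by positivity) one_pos, min_le_right _ _, ?_⟩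
  filter_upwards [hC.bound, hc.bound, eventually_ge_atTop 2] with n h1 h2 hn
  have hV : 1 < Fintype.card (V n) := by rw [hcard]; omega
  set lam := secondEigenvalue (lazyWalkMatrix (G n)) with hlam
  have hle : lam ≤ 1 := secondEigenvalue_le_one (hG n hn) hV
  have hrel : relaxationTime (G n) = 1 / (1 - lam) := rfl
  -- If `lam = 1`, the relaxation time is `1 / 0 = 0` by convention. This is where the lower bound
  -- in `Θ(1)` is needed.
  have hlt : lam < 1 := by
    refine lt_of_le_of_ne hle fun h => ?_
    rw [hrel, h] at h2
    norm_num at h2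
  have hpos : 0 < 1 - lam := by linarith
  rw [hrel, Real.norm_of_nonneg (by positivity), norm_one, mul_one, div_le_iff₀ hpos] at h1
  have hgap : 1 / C ≤ 1 - lam := by
    rw [div_le_iff₀ hC0]; linarith
  intro f hf
  refine (degInner_lazyAvg_self_le (hG n hn) hV hf).trans ?_
  refine mul_le_mul_of_nonneg_right ?_ (degInner_self_nonneg f)
  linarith [min_le_left (1 / C) 1]

lemma eventually_hittingTime_le (hcard : ∀ n, Fintype.card (V n) = n)
    (hG : ∀ n, 2 ≤ n → ∀ x, 0 < (G n).degree x) {D : ℕ} (hD2 : 2 ≤ D)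
    (hD : ∀ n x, (G n).degree x ≤ D) {γ : ℝ} (hγ0 : 0 < γ) (hγ1 : γ ≤ 1)
    (hγ : ∀ᶠ n in atTop, HasGap (G n) γ) {ε : ℝ} (hε : 0 < ε) :
    ∀ᶠ n : ℕ in atTop, hittingTime (G n) ≤ ENNReal.ofReal (ε * n) := by
  have hD2' : (2 : ℝ) ≤ D := by exact_mod_cast hD2
  have hinv : 1 / (D : ℝ) ≤ 1 := by rw [div_le_one (by linarith)]; linarith
  have hinv0 : 0 < 1 / (D : ℝ) := by positivity
  have ho := ((isLittleO_log_rpow_atTop hinv0).comp_tendsto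
    tendsto_natCast_atTop_atTop).def (c := ε * γ / (48 * D)) (by positivity)
  filter_upwards [hγ, exists_mixing_time hγ0 hγ1 (by omega : 1 ≤ D), ho,
    eventually_ge_atTop 2] with n hn ⟨T, hT0, hTle, hT⟩ hlog hn2
  have h := hn.hittingTime_le (hG n hn2) hD2 (hD n) hγ1 hT0 (by rw [hcard]; exact hT)
  refine h.trans (ENNReal.ofReal_le_ofReal ?_)
  rw [hcard]
  have hn0 : (0 : ℝ) < n := by exact_mod_cast (by omega : 0 < n)
  simp only [Function.comp_apply] at hlog
  rw [Real.norm_of_nonneg (Real.log_natCast_nonneg n),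
    Real.norm_of_nonneg (by positivity)] at hlog
  have h1 : (6 * D * (n : ℝ)) ^ (1 - 1 / (D : ℝ)) ≤ 6 * D * (n : ℝ) ^ (1 - 1 / (D : ℝ)) := by
    rw [Real.mul_rpow (by positivity) hn0.le]
    refine mul_le_mul_of_nonneg_right ?_ (by positivity)
    calc (6 * (D : ℝ)) ^ (1 - 1 / (D : ℝ)) ≤ (6 * (D : ℝ)) ^ (1 : ℝ) :=
          Real.rpow_le_rpow_of_exponent_le (by linarith) (by linarith)
      _ = _ := Real.rpow_one _
  have h2 : (n : ℝ) ^ (1 / (D : ℝ)) * (n : ℝ) ^ (1 - 1 / (D : ℝ)) = n := by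
    rw [← Real.rpow_add hn0, add_sub_cancel, Real.rpow_one]
  calc 2 * T * (6 * D * (n : ℝ)) ^ (1 - 1 / (D : ℝ))
      ≤ 2 * (4 / γ * (ε * γ / (48 * D) * (n : ℝ) ^ (1 / (D : ℝ)))) *
          (6 * D * (n : ℝ) ^ (1 - 1 / (D : ℝ))) := by
        refine mul_le_mul (mul_le_mul_of_nonneg_left ?_ zero_le_two) h1 (by positivity)
          (by positivity)
        exact hTle.trans (mul_le_mul_of_nonneg_left hlog (by positivity))
    _ = ε * ((n : ℝ) ^ (1 / (D : ℝ)) * (n : ℝ) ^ (1 - 1 / (D : ℝ))) := by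
        field_simp; ring
    _ = ε * n := by rw [h2]

lemma eventually_coverTime_le (hcard : ∀ n, Fintype.card (V n) = n)
    (hG : ∀ n, 2 ≤ n → ∀ x, 0 < (G n).degree x) {D : ℕ} (hD2 : 2 ≤ D)
    (hD : ∀ n x, (G n).degree x ≤ D) {γ : ℝ} (hγ0 : 0 < γ) (hγ1 : γ ≤ 1)
    (hγ : ∀ᶠ n in atTop, HasGap (G n) γ) :
    ∀ᶠ n : ℕ in atTop, coverTime (G n) ≤ ENNReal.ofReal
      ((2 * D / γ * (2 * D + 1) + 1 + 96 * D / γ + 16 / γ) *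
        (n * Real.log (Real.log n))) := by
  have hD2' : (2 : ℝ) ≤ D := by exact_mod_cast hD2
  have hlog : Tendsto (fun n : ℕ => Real.log n) atTop atTop :=
    Real.tendsto_log_atTop.comp tendsto_natCast_atTop_atTop
  have hloglog : Tendsto (fun n : ℕ => Real.log (Real.log n)) atTop atTop :=
    Real.tendsto_log_atTop.comp hlog
  filter_upwards [hγ, exists_mixing_time hγ0 hγ1 (by omega : 1 ≤ D),
    hlog.eventually_ge_atTop 1, hloglog.eventually_ge_atTop 1,
    eventually_ge_atTop 2] with n hn ⟨T, hT0, hTle, hT⟩ hL hLL hn2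
  set L := Real.log n with hLdef
  have hL0 : 0 < L := by linarith
  have hn1 : (1 : ℝ) ≤ n := by exact_mod_cast (by omega : 1 ≤ n)
  -- With threshold `L ^ (2D)`, the factor `E = L ^ (-2)` cancels both `T = O(L)` and the harmonic
  -- sum, so `A = O(n)`.
  have hB1 : 1 ≤ L ^ (2 * D) := one_le_pow₀ hL
  set E : ℝ := (L ^ (2 * D)) ^ (-(1 / (D : ℝ))) with hE
  have hEL : E = (L ^ 2)⁻¹ := by
    rw [hE, ← Real.rpow_natCast, ← Real.rpow_mul hL0.le,
      show ((2 * D : ℕ) : ℝ) * -(1 / (D : ℝ)) = -(2 : ℕ) by push_cast; field_simp,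
      Real.rpow_neg hL0.le, Real.rpow_natCast]
  set M : ℝ := D * n / γ with hM
  have hM0 : 0 < M := by positivity
  -- The first phase is long enough to give `exp (-y / (2M)) = L ^ (-(2D+1))`, which cancels the
  -- price `2 T L ^ (2D)` per missed vertex.
  set y : ℝ := 2 * M * ((2 * D + 1 : ℕ) * Real.log L) with hy
  have hy0 : 0 ≤ y := by positivity
  have h := hn.coverTime_le (hG n hn2) hD2 (hD n) hγ0 hγ1 hT0 (by rw [hcard]; exact hT)
    (A := 2 * T * (6 * D * n * (1 + L)) * E) (B := 2 * T * L ^ (2 * D))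
    (by positivity) (by positivity)
    (fun s hs => by rw [hcard] at hs ⊢; exact coverCost_le (by omega) hs hB1) ⌈y⌉₊
  refine h.trans (ENNReal.ofReal_le_ofReal ?_)
  rw [hcard, ← hM]
  have hexp : Real.exp (-⌈y⌉₊ / (2 * M)) ≤ (L ^ (2 * D + 1))⁻¹ := by
    have h1 : -(⌈y⌉₊ : ℝ) / (2 * M) ≤ -((2 * D + 1 : ℕ) * Real.log L) := by
      rw [div_le_iff₀ (by positivity)]
      have := Nat.le_ceil y
      rw [hy] at this ⊢
      linarith
    refine (Real.exp_le_exp.2 h1).trans (le_of_eq ?_)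
    rw [Real.exp_neg, Real.exp_nat_mul, Real.exp_log hL0]
  have ht : (⌈y⌉₊ : ℝ) ≤ 2 * D / γ * (2 * D + 1) * (n * Real.log L) + 1 := by
    refine (Nat.ceil_lt_add_one hy0).le.trans (le_of_eq ?_)
    rw [hy, hM]; push_cast; ring
  have hA : 2 * T * (6 * D * n * (1 + L)) * E ≤ 96 * D / γ * n := by
    calc 2 * T * (6 * D * n * (1 + L)) * E
        ≤ 2 * (4 / γ * L) * (6 * D * n * (L + L)) * (L ^ 2)⁻¹ := by
          rw [hEL]; gcongr
      _ = 96 * D / γ * n := by field_simp; ring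
  have hB : 2 * (2 * T * L ^ (2 * D)) * n * Real.exp (-⌈y⌉₊ / (2 * M)) ≤ 16 / γ * n := by
    calc 2 * (2 * T * L ^ (2 * D)) * n * Real.exp (-⌈y⌉₊ / (2 * M))
        ≤ 2 * (2 * (4 / γ * L) * L ^ (2 * D)) * n * (L ^ (2 * D + 1))⁻¹ := by gcongr
      _ = 16 / γ * n := by rw [pow_succ]; field_simp; ring
  have hnl : (n : ℝ) ≤ n * Real.log L := le_mul_of_one_le_right (by linarith) hLL
  have h3 : 96 * D / γ * (n : ℝ) ≤ 96 * D / γ * (n * Real.log L) :=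
    mul_le_mul_of_nonneg_left hnl (by positivity)
  have h4 : 16 / γ * (n : ℝ) ≤ 16 / γ * (n * Real.log L) :=
    mul_le_mul_of_nonneg_left hnl (by positivity)
  linarith

end Asymptotic

end ChoiceWalk

theorem corollary5p3 {V : ℕ → Type*} [∀ n, Fintype (V n)] [∀ n, DecidableEq (V n)]
    (G : (n : ℕ) → SimpleGraph (V n)) [∀ n, DecidableRel (G n).Adj]
    (hcard : ∀ n, Fintype.card (V n) = n)
    (hconn : ∀ n, 1 ≤ n → (G n).Connected)
    (hdeg : ∃ d : ℕ, ∀ n, (G n).maxDegree ≤ d)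
    (hexp : (fun n => ChoiceWalk.relaxationTime (G n)) =Θ[atTop] fun _ => (1 : ℝ)) :
    (∃ C : ℝ, 0 < C ∧ ∀ᶠ n : ℕ in atTop,
      ChoiceWalk.coverTime (G n) ≤ ENNReal.ofReal (C * (n * Real.log (Real.log n)))) ∧
    (∀ ε : ℝ, 0 < ε → ∀ᶠ n : ℕ in atTop,
      ChoiceWalk.hittingTime (G n) ≤ ENNReal.ofReal (ε * n)) := by
  obtain ⟨d, hd⟩ := hdeg
  have hG : ∀ n, 2 ≤ n → ∀ x, 0 < (G n).degree x := by
    intro n hn x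
    have : Nontrivial (V n) := Fintype.one_lt_card_iff_nontrivial.1 (by rw [hcard]; omega)
    exact (hconn n (by omega)).preconnected.degree_pos_of_nontrivial x
  -- Enlarging the bound to at least `2` guarantees the exponent `1 - 1/D ≥ 1/2`.
  have hD : ∀ n x, (G n).degree x ≤ max d 2 := fun n x =>
    ((G n).degree_le_maxDegree x).trans ((hd n).trans (le_max_left _ _))
  obtain ⟨γ, hγ0, hγ1, hγ⟩ := ChoiceWalk.eventually_hasGap hcard hG hexp
  refine ⟨⟨_, ?_, ChoiceWalk.eventually_coverTime_le hcard hG (le_max_right d 2) hD hγ0 hγ1 hγ⟩,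
    fun ε hε => ChoiceWalk.eventually_hittingTime_le hcard hG (le_max_right d 2) hD hγ0 hγ1 hγ hε⟩
  positivity
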